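/- Let $f_0,f_1$ be probability densities on $\mathbb R$ such that the probability measures $P_i(dx)=f_i(x)\,dx$ are distinct and mutually absolutely continuous; let $\pi_0\in[0,1]$ and $c>0$. Consider infinitely many independent sequences $(Y^s_k)_{k}$; each one is, independently of the others, of type $1$ with probability $\pi_0$ and of type $0$ with probability $1-\pi_0$, and given type $i$ its samples are i.i.d. with density $f_i$. *Scanning stage.* At times $k=1,2,\dots$ the observer sees $Z_k=Y_k^{s_k^1}+Y_k^{s_k^2}$, where $(s_k^1,s_k^2)$ is the current pair of sequences. A scanning strategy $(\tau_0,\phi)$ consists of decisions $\phi_k\in\{0,1\}$, $k\ge 0$, measurable with respect to $\mathcal F_k=\sigma(Z_1,\dots,Z_k)$ ($\phi_k=0$: keep the current pair; $\phi_k=1$: move on to a pair of two new sequences), and a stopping time $\tau_0$ of $(\mathcal F_k)_{k\ge0}$. Let $p_k^{1,1}$ and $p_k^{mix}$ be the conditional probabilities given $\mathcal F_k$ that both, respectively exactly one, of $s_k^1,s_k^2$ are of type $1$; thus $p_0^{1,1}=\pi_0^2$ and $p_0^{mix}=2\pi_0(1-\pi_0)$. Let $\mathcal P=\{(p^{1,1},p^{mix}):p^{1,1},p^{mix}\ge0,\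 p^{1,1}+p^{mix}\le1\}$. *Refinement cost.* For $p=(p^{1,1},p^{mix})\in\mathcal P$ let two candidate sequences have types $(1,1),(1,0),(0,1),(0,0)$ with probabilities $p^{1,1},\,p^{mix}/2,\,p^{mix}/2,\,1-p^{1,1}-p^{mix}$, let $X_1,X_2,\dots$ be samples of the first candidate (i.i.d. with density $f_i$ given that it is of type $i$), and let $q_{1,j},q_{2,j}$ be the conditional probabilities given $\mathcal G_j=\sigma(X_1,\dots,X_j)$ that the first, respectively second, candidate is of type $1$. Put $$v(p)=\inf_{\tau_1}\mathbb E\big[c\tau_1+1-\max\{q_{1,\tau_1},q_{2,\tau_1}\}\big],$$ the infimum being over all stopping times $\tau_1\ge 0$ of $(\mathcal G_j)_{j\ge0}$. The scanning problem is to minimize $\mathbb E\big[c\tau_0+v(p^{1,1}_{\tau_0},p^{mix}_{\tau_0})\big]$ over all scanning strategies $(\tau_0,\phi)$ (the cost is $+\infty$ if $P(\tau_0=\infty)>0$). *Optimality equation.* Let $g_0=f_0*f_0$, $g_1=f_0*f_1$, $g_2=f_1*f_1$, let $g(p,z)=(1-p^{1,1}-p^{mix})g_0(z)+p^{mix}g_1(z)+p^{1,1}g_2(z)$,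 and for a bounded measurable function $U$ on $\mathcal P$ let $$\Phi_c(p)=\int_{\mathbb R} U\Big(\frac{p^{1,1}g_2(z)}{g(p,z)},\frac{p^{mix}g_1(z)}{g(p,z)}\Big)g(p,z)\,dz,\qquad \Phi_s=\Phi_c(p_0^{1,1},p_0^{mix}).$$ **Theorem.** The equation $$U(p)=\min\big\{v(p),\ c+\min\{\Phi_c(p),\Phi_s\}\big\},\qquad p\in\mathcal P,$$ has a bounded measurable solution $U:\mathcal P\to\mathbb R$, and for every such solution the following holds. 1. $\Phi_c$ and the constant $\Phi_s$ are the conditional expected next values of $U$ when the observer continues and when the observer switches: for every scanning strategy and every $k\ge0$, almost surely $\mathbb E[U(p_{k+1}^{1,1},p_{k+1}^{mix})\mid\mathcal F_k]$ equals $\Phi_c(p_k^{1,1},p_k^{mix})$ on $\{\phi_k=0\}$ and $\Phi_s$ on $\{\phi_k=1\}$. 2. There is a scanning strategy $(\tau_0^*,\phi^*)$ such that, almost surely, $$\tau_0^*=\inf\{k\ge0:\ v(p_k^{1,1},p_k^{mix})=U(p_k^{1,1},p_k^{mix})\}$$ and, for all $k\ge0$, $\phi_k^*=0$ if $\Phi_c(p_k^{1,1},p_k^{mix})\le\Phi_s$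 and $\phi_k^*=1$ otherwise, where $p_k^{1,1},p_k^{mix}$ are the posterior probabilities under this strategy. 3. Every scanning strategy with the properties in 2 is optimal: its cost is at most the cost of every other scanning strategy. -/

import Mathlib

open MeasureTheory ProbabilityTheory
open scoped ENNReal

noncomputable section

namespace MixedSearch

/-! ### Densities -/

/-- `f` is a probability density function on the real line. -/
structure IsPdf (f : ℝ → ℝ) : Prop where
  measurable : Measurable f
  nonneg : ∀ x, 0 ≤ f x
  lintegral_eq_one : ∫⁻ x, ENNReal.ofReal (f x) = 1

/-- The measure on the real line with density `f`. -/
def pdfMeasure (f : ℝ → ℝ) : Measure ℝ :=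
  volume.withDensity fun x => ENNReal.ofReal (f x)

/-- The convolution `f * h` of two densities. -/
def conv (f h : ℝ → ℝ) : ℝ → ℝ :=
  convolution f h (ContinuousLinearMap.mul ℝ ℝ) volume

/-! ### The sequences -/

/-- Sample space of all the sequences: for each sequence `s`, its type (`true` if it is generated
by `f₁`, `false` if it is generated by `f₀`) and its samples. -/
abbrev Space : Type := ℕ → Bool × (ℕ → ℝ)

/-- Law of one sequence: with probability `π₀` its samples are i.i.d. with density `f₁`, and with
probability `1 - π₀` they are i.i.d. with density `f₀`. -/
def seqLaw (f₀ f₁ : ℝ → ℝ) (π₀ : ℝ) : Measure (Bool × (ℕ → ℝ)) :=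
  ENNReal.ofReal (1 - π₀) •
      (Measure.dirac false).prod (Measure.infinitePi fun _ : ℕ => pdfMeasure f₀) +
    ENNReal.ofReal π₀ •
      (Measure.dirac true).prod (Measure.infinitePi fun _ : ℕ => pdfMeasure f₁)

/-- Law of the independent sequences. -/
def law (f₀ f₁ : ℝ → ℝ) (π₀ : ℝ) : Measure Space :=
  Measure.infinitePi fun _ : ℕ => seqLaw f₀ f₁ π₀

/-- `H s ω = true` iff the sequence `s` is generated by `f₁`. -/
def H (s : ℕ) (ω : Space) : Bool := (ω s).1

/-- `Y s k` is the sample of the sequence `s` at time `k`. -/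
def Y (s k : ℕ) (ω : Space) : ℝ := (ω s).2 k

lemma measurable_Y (s k : ℕ) : Measurable (Y s k) :=
  (measurable_pi_apply k).comp (measurable_snd.comp (measurable_pi_apply s))

/-! ### The scanning stage -/

/-- Number of switches decided before time `k`; `φ i ω = true` means a switch decided at time `i`.
At time `k` the observer is at the pair of sequences with this number. -/
def pairIdx (φ : ℕ → Space → Bool) : ℕ → Space → ℕ
  | 0, _ => 0
  | k + 1, ω => pairIdx φ k ω + (φ k ω).toNat

/-- The two sequences observed at time `k`: each pair consists of two fresh sequences. -/
def seqOne (φ : ℕ → Space → Bool) (k : ℕ) (ω : Space) : ℕ := 2 * pairIdx φ k ω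

/-- See `seqOne`. -/
def seqTwo (φ : ℕ → Space → Bool) (k : ℕ) (ω : Space) : ℕ := 2 * pairIdx φ k ω + 1

/-- The mixed observation at time `k`. Observations start at time `1`; the value at time `0` is a
constant and carries no information. -/
def Z (φ : ℕ → Space → Bool) : ℕ → Space → ℝ
  | 0, _ => 0
  | k + 1, ω => Y (seqOne φ (k + 1) ω) (k + 1) ω + Y (seqTwo φ (k + 1) ω) (k + 1) ω

lemma measurable_pairIdx {φ : ℕ → Space → Bool} (hφ : ∀ k, Measurable (φ k)) (k : ℕ) :
    Measurable (pairIdx φ k) := by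
  induction k with
  | zero => exact measurable_const
  | succ k ih => exact ih.add ((measurable_of_countable Bool.toNat).comp (hφ k))

lemma measurable_Z {φ : ℕ → Space → Bool} (hφ : ∀ k, Measurable (φ k)) (k : ℕ) :
    Measurable (Z φ k) := by
  cases k with
  | zero => exact measurable_const
  | succ k =>
    have h : ∀ g : ℕ → ℕ, Measurable fun ω => Y (g (pairIdx φ (k + 1) ω)) (k + 1) ω := fun g =>
      (measurable_from_prod_countable_right
        (f := fun x : ℕ × Space => Y (g x.1) (k + 1) x.2)
        fun n => measurable_Y (g n) (k + 1)).comp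
          ((measurable_pairIdx hφ (k + 1)).prodMk measurable_id)
    exact (h fun n => 2 * n).add (h fun n => 2 * n + 1)

/-- The filtration `σ(Z₁, …, Z_k)` of the scanning observations. -/
def scanFiltration (φ : ℕ → Space → Bool) (hφ : ∀ k, Measurable (φ k)) :
    Filtration ℕ (inferInstance : MeasurableSpace Space) :=
  Filtration.natural (Z φ) fun k => (measurable_Z hφ k).stronglyMeasurable

/-- An admissible scanning strategy: a switching rule `φ` whose decision at time `k` is a function
of the observations up to time `k`, and a stopping time `τ` of the observation filtration. -/
structure ScanStrategy where
  φ : ℕ → Space → Bool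
  measurable_φ : ∀ k, Measurable (φ k)
  adapted_φ : ∀ k, Measurable[scanFiltration φ measurable_φ k] (φ k)
  τ : Space → ℕ∞
  isStoppingTime_τ : IsStoppingTime (scanFiltration φ measurable_φ) τ

namespace ScanStrategy

/-- The observation filtration of a strategy. -/
def F (S : ScanStrategy) : Filtration ℕ (inferInstance : MeasurableSpace Space) :=
  scanFiltration S.φ S.measurable_φ

/-- Event that both currently observed sequences are generated by `f₁`. -/
def bothEvent (S : ScanStrategy) (k : ℕ) : Set Space :=
  {ω | H (seqOne S.φ k ω) ω = true ∧ H (seqTwo S.φ k ω) ω = true}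

/-- Event that exactly one of the currently observed sequences is generated by `f₁`. -/
def mixEvent (S : ScanStrategy) (k : ℕ) : Set Space :=
  {ω | H (seqOne S.φ k ω) ω ≠ H (seqTwo S.φ k ω) ω}

/-- The pair of posterior probabilities `(p_k^{1,1}, p_k^{mix})` given the observations up to
time `k`. -/
def posterior (f₀ f₁ : ℝ → ℝ) (π₀ : ℝ) (S : ScanStrategy) (k : ℕ) (ω : Space) : ℝ × ℝ :=
  ((law f₀ f₁ π₀)[(S.bothEvent k).indicator (fun _ => (1 : ℝ)) | S.F k] ω,
    (law f₀ f₁ π₀)[(S.mixEvent k).indicator (fun _ => (1 : ℝ)) | S.F k] ω)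

end ScanStrategy

/-! ### The refinement stage -/

/-- Sample space of the refinement stage: the types of the two candidates, and the samples `X_j`,
all taken from the first candidate. -/
abbrev RefineSpace : Type := (Bool × Bool) × (ℕ → ℝ)

/-- Law of the refinement stage when the types of the two candidates have prior weights `r`. -/
def refineLaw (f₀ f₁ : ℝ → ℝ) (r : Bool × Bool → ℝ) : Measure RefineSpace :=
  ∑ h : Bool × Bool, ENNReal.ofReal (r h) •
    (Measure.dirac h).prod
      (Measure.infinitePi fun _ : ℕ => pdfMeasure (if h.1 = true then f₁ else f₀))

/-- The sample at time `j` of the refinement stage. Samples start at time `1`; the value at time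
`0` is a constant and carries no information. -/
def X : ℕ → RefineSpace → ℝ
  | 0, _ => 0
  | j + 1, ω => ω.2 (j + 1)

lemma measurable_X (j : ℕ) : Measurable (X j) := by
  cases j with
  | zero => exact measurable_const
  | succ j => exact (measurable_pi_apply (j + 1)).comp measurable_snd

/-- The filtration `σ(X₁, …, X_j)`. -/
def G : Filtration ℕ (inferInstance : MeasurableSpace RefineSpace) :=
  Filtration.natural X fun j => (measurable_X j).stronglyMeasurable

/-- Posterior probability that the first candidate is generated by `f₁`. -/
def q₁ (f₀ f₁ : ℝ → ℝ) (r : Bool × Bool → ℝ) (j : ℕ) : RefineSpace → ℝ :=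
  (refineLaw f₀ f₁ r)[{ω : RefineSpace | ω.1.1 = true}.indicator (fun _ => (1 : ℝ)) | G j]

/-- Posterior probability that the second candidate is generated by `f₁`. -/
def q₂ (f₀ f₁ : ℝ → ℝ) (r : Bool × Bool → ℝ) (j : ℕ) : RefineSpace → ℝ :=
  (refineLaw f₀ f₁ r)[{ω : RefineSpace | ω.1.2 = true}.indicator (fun _ => (1 : ℝ)) | G j]

/-- Expected cost `E[c τ + 1 - max (q_{1,τ}, q_{2,τ})]` of the refinement stage. It is infinite if
`τ` is infinite with positive probability. -/
def refineCost (f₀ f₁ : ℝ → ℝ) (c : ℝ) (r : Bool × Bool → ℝ) (τ : RefineSpace → ℕ∞) : ℝ≥0∞ :=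
  ∫⁻ ω, (ENNReal.ofReal c * (τ ω : ℝ≥0∞) +
    ENNReal.ofReal (1 - max (stoppedValue (q₁ f₀ f₁ r) τ ω) (stoppedValue (q₂ f₀ f₁ r) τ ω)))
      ∂(refineLaw f₀ f₁ r)

/-- Optimal cost of the refinement stage for the prior weights `r`. -/
def refineValue (f₀ f₁ : ℝ → ℝ) (c : ℝ) (r : Bool × Bool → ℝ) : ℝ :=
  (⨅ (τ : RefineSpace → ℕ∞) (_ : IsStoppingTime G τ), refineCost f₀ f₁ c r τ).toReal

/-- Weights of the four pairs of types when `p = (p^{1,1}, p^{mix})`. -/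
def initialWeights (p : ℝ × ℝ) : Bool × Bool → ℝ
  | (true, true) => p.1
  | (true, false) => p.2 / 2
  | (false, true) => p.2 / 2
  | (false, false) => 1 - p.1 - p.2

/-- The optimal cost `v (p^{1,1}, p^{mix})` of a refinement stage that starts with these posterior
probabilities. -/
def v (f₀ f₁ : ℝ → ℝ) (c : ℝ) (p : ℝ × ℝ) : ℝ :=
  refineValue f₀ f₁ c (initialWeights p)

/-! ### The scanning problem -/

/-- Expected cost `E[c τ + v (p_τ^{1,1}, p_τ^{mix})]` of a scanning strategy. It is infinite if `τ`
is infinite with positive probability. -/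
def scanCost (f₀ f₁ : ℝ → ℝ) (π₀ c : ℝ) (S : ScanStrategy) : ℝ≥0∞ :=
  ∫⁻ ω, (ENNReal.ofReal c * (S.τ ω : ℝ≥0∞) +
    ENNReal.ofReal (v f₀ f₁ c (stoppedValue (S.posterior f₀ f₁ π₀) S.τ ω))) ∂(law f₀ f₁ π₀)

/-- The strategy attains the infimum of the scanning cost over all admissible strategies. -/
def IsOptimal (f₀ f₁ : ℝ → ℝ) (π₀ c : ℝ) (S : ScanStrategy) : Prop :=
  ∀ S' : ScanStrategy, scanCost f₀ f₁ π₀ c S ≤ scanCost f₀ f₁ π₀ c S'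

/-! ### The optimality equation -/

/-- The domain of `(p^{1,1}, p^{mix})`. -/
def simplex : Set (ℝ × ℝ) := {p | 0 ≤ p.1 ∧ 0 ≤ p.2 ∧ p.1 + p.2 ≤ 1}

/-- The prior point `(p_0^{1,1}, p_0^{mix})`. -/
def prior (π₀ : ℝ) : ℝ × ℝ := (π₀ ^ 2, 2 * π₀ * (1 - π₀))

/-- Density `g (p, z)` of the next mixed observation. -/
def mixDensity (f₀ f₁ : ℝ → ℝ) (p : ℝ × ℝ) (z : ℝ) : ℝ :=
  (1 - p.1 - p.2) * conv f₀ f₀ z + p.2 * conv f₀ f₁ z + p.1 * conv f₁ f₁ z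

/-- Bayes update of `(p^{1,1}, p^{mix})` by a mixed observation `z` of the same pair. -/
def bayes (f₀ f₁ : ℝ → ℝ) (p : ℝ × ℝ) (z : ℝ) : ℝ × ℝ :=
  (p.1 * conv f₁ f₁ z / mixDensity f₀ f₁ p z, p.2 * conv f₀ f₁ z / mixDensity f₀ f₁ p z)

/-- Expected next value of `U` if the observer continues with a pair of posterior `p`. -/
def Φc (f₀ f₁ : ℝ → ℝ) (U : ℝ × ℝ → ℝ) (p : ℝ × ℝ) : ℝ :=
  ∫ z, U (bayes f₀ f₁ p z) * mixDensity f₀ f₁ p z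

/-- Expected next value of `U` if the observer switches to a new pair. -/
def Φs (f₀ f₁ : ℝ → ℝ) (π₀ : ℝ) (U : ℝ × ℝ → ℝ) : ℝ :=
  ∫ z, U (bayes f₀ f₁ (prior π₀) z) * mixDensity f₀ f₁ (prior π₀) z

/-- `U` is a bounded measurable solution, on the simplex, of
`U = min {v, c + min {Φ_c, Φ_s}}`. -/
structure IsSolution (f₀ f₁ : ℝ → ℝ) (π₀ c : ℝ) (U : ℝ × ℝ → ℝ) : Prop where
  measurable : Measurable fun p : simplex => U p
  bounded : ∃ B, ∀ p ∈ simplex, |U p| ≤ B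
  eq_min : ∀ p ∈ simplex,
    U p = min (v f₀ f₁ c p) (c + min (Φc f₀ f₁ U p) (Φs f₀ f₁ π₀ U))

/-- The stopping time of `S` is almost surely `inf {k ≥ 0 : v (p_k) = U (p_k)}`. -/
def StopsByRule (f₀ f₁ : ℝ → ℝ) (π₀ c : ℝ) (U : ℝ × ℝ → ℝ) (S : ScanStrategy) : Prop :=
  ∀ᵐ ω ∂(law f₀ f₁ π₀), S.τ ω =
    ⨅ (k : ℕ) (_ : v f₀ f₁ c (S.posterior f₀ f₁ π₀ k ω) = U (S.posterior f₀ f₁ π₀ k ω)), (k : ℕ∞)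

/-- Almost surely, at every time `k`, the observer continues with the current pair if
`Φ_c (p_k) ≤ Φ_s`, and switches otherwise. -/
def SwitchesByRule (f₀ f₁ : ℝ → ℝ) (π₀ : ℝ) (U : ℝ × ℝ → ℝ) (S : ScanStrategy) : Prop :=
  ∀ᵐ ω ∂(law f₀ f₁ π₀), ∀ k : ℕ,
    S.φ k ω = false ↔ Φc f₀ f₁ U (S.posterior f₀ f₁ π₀ k ω) ≤ Φs f₀ f₁ π₀ U

/-- `Φ_c (p_k)` and `Φ_s` are the conditional expectations of the next value of `U` given the
observations up to time `k`, when the observer continues and when the observer switches. -/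
def IsNextValue (f₀ f₁ : ℝ → ℝ) (π₀ : ℝ) (U : ℝ × ℝ → ℝ) : Prop :=
  ∀ (S : ScanStrategy) (k : ℕ), ∀ᵐ ω ∂(law f₀ f₁ π₀),
    (law f₀ f₁ π₀)[fun ω' => U (S.posterior f₀ f₁ π₀ (k + 1) ω') | S.F k] ω =
      if S.φ k ω = false then Φc f₀ f₁ U (S.posterior f₀ f₁ π₀ k ω) else Φs f₀ f₁ π₀ U

end MixedSearch

end

/-! The theorem is a verification argument. A solution `U` is compared with an arbitrary strategy
through the process `c k + U(p_k)`, stopped at `τ`. The inequality `U ≤ c + min {Φ_c, Φ_s}` makes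
its conditional drift nonnegative whichever way the observer decides, and `U ≤ v` bounds the
terminal payment; hence every strategy costs at least `U (prior π₀)` (`ofReal_le_scanCost`). Under
the stated rules the drift vanishes before `τ` and `U = v` at `τ`, so this bound is attained
(`scanCost_eq_of_rule`). Both facts hold for each bounded solution separately, so uniqueness of `U`
is never needed.

The drift formula rests on a filtering statement: the pair of posteriors is almost surely the
explicit Bayes recursion `belief`, and the next observation has conditional density `mixDensity` at
the current belief, or at the prior after a switch. Since the sequences being observed are
themselves random, independence is used by resampling coordinates of the product measure on each
event where the pair number is fixed. A sample at time `k + 1` is not seen by time `k`, and a pair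
just switched to has not been looked at. This gives `isCondLaw`, `posterior_ae_eq` and
`condExp_belief`.

A solution is the increasing limit of value iteration started at `0` (`exists_solution`). This
requires `v` to be measurable, although it is an infimum over uncountably many stopping times of
costs whose posteriors depend on `p`. Replacing the maximum of the posteriors by an explicit choice
of a candidate makes the cost of a fixed rule linear in the weights of the types. Hence `v` is an
infimum of continuous functions, which is upper semicontinuous and so Borel (`isUnitCost_v`). -/

noncomputable section

namespace MixedSearch

/-! ### Resampling a coordinate -/

section Update

variable {ι : Type*} [DecidableEq ι] {E : ι → Type*} [∀ i, MeasurableSpace (E i)]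

lemma measurable_update_pair (n : ι) :
    Measurable fun p : (∀ i, E i) × E n => Function.update p.1 n p.2 := by
  refine measurable_pi_lambda _ fun i => ?_
  by_cases h : i = n
  · subst h
    simpa using measurable_snd
  · simp only [Function.update_of_ne h]
    exact (measurable_pi_apply i).comp measurable_fst

/-- On a box the new coordinate splits off as an independent factor, which restores exactly the
factor lost by erasing `n`. -/
lemma map_update_infinitePi (ν : ∀ i, Measure (E i)) [∀ i, IsProbabilityMeasure (ν i)] (n : ι) :
    ((Measure.infinitePi ν).prod (ν n)).map (fun p => Function.update p.1 n p.2) =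
      Measure.infinitePi ν := by
  refine Measure.eq_infinitePi ν fun s t ht => ?_
  rw [Measure.map_apply (measurable_update_pair n)
    (.pi s.countable_toSet fun i _ => ht i)]
  by_cases hn : n ∈ s
  · have : (fun p : (∀ i, E i) × E n => Function.update p.1 n p.2) ⁻¹' (s : Set ι).pi t =
        ((s.erase n : Finset ι) : Set ι).pi t ×ˢ t n := by
      ext ⟨x, y⟩
      simp only [Set.mem_preimage, Set.mem_pi, Set.mem_prod, Finset.mem_coe, Finset.mem_erase]
      constructor
      · intro h
        refine ⟨fun i hi => ?_, by simpa using h n hn⟩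
        simpa [Function.update_of_ne hi.1] using h i hi.2
      · rintro ⟨h, hy⟩ i hi
        by_cases hin : i = n
        · subst hin
          simpa using hy
        · simpa [Function.update_of_ne hin] using h i ⟨hin, hi⟩
    rw [this, Measure.prod_prod, Measure.infinitePi_pi _ fun i _ => ht i,
      Finset.prod_erase_mul _ _ hn]
  · have : (fun p : (∀ i, E i) × E n => Function.update p.1 n p.2) ⁻¹' (s : Set ι).pi t =
        (s : Set ι).pi t ×ˢ Set.univ := by
      ext ⟨x, y⟩
      simp only [Set.mem_preimage, Set.mem_pi, Set.mem_prod, Finset.mem_coe, Set.mem_univ,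
        and_true]
      refine forall₂_congr fun i hi => ?_
      rw [Function.update_of_ne (ne_of_mem_of_not_mem hi hn)]
    rw [this, Measure.prod_prod, Measure.infinitePi_pi _ fun i _ => ht i, measure_univ, mul_one]

/-- Serves as conditioning on all coordinates but `n`: whatever part of `F` ignores coordinate `n`
is a constant for the inner integral. -/
lemma lintegral_infinitePi_update (ν : ∀ i, Measure (E i)) [∀ i, IsProbabilityMeasure (ν i)]
    (n : ι) {F : (∀ i, E i) → ℝ≥0∞} (hF : Measurable F) :
    ∫⁻ x, F x ∂Measure.infinitePi ν =
      ∫⁻ x, ∫⁻ y, F (Function.update x n y) ∂ν n ∂Measure.infinitePi ν := by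
  conv_lhs => rw [← map_update_infinitePi ν n]
  rw [lintegral_map hF (measurable_update_pair n),
    lintegral_prod (fun p : (∀ i, E i) × E n => F (Function.update p.1 n p.2))
      (hF.comp (measurable_update_pair n)).aemeasurable]

end Update

/-! ### The law of the sequences -/

lemma IsPdf.isProbabilityMeasure {f : ℝ → ℝ} (hf : IsPdf f) :
    IsProbabilityMeasure (pdfMeasure f) :=
  ⟨by rw [pdfMeasure, withDensity_apply _ MeasurableSet.univ, Measure.restrict_univ,
    hf.lintegral_eq_one]⟩

lemma IsPdf.integrable {f : ℝ → ℝ} (hf : IsPdf f) : Integrable f := by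
  refine ⟨hf.measurable.aestronglyMeasurable, ?_⟩
  rw [hasFiniteIntegral_iff_ofReal (Filter.Eventually.of_forall hf.nonneg),
    hf.lintegral_eq_one]
  exact ENNReal.one_lt_top

lemma IsPdf.lintegral_pdfMeasure {f : ℝ → ℝ} (hf : IsPdf f) (h : ℝ → ℝ≥0∞) :
    ∫⁻ x, h x ∂pdfMeasure f = ∫⁻ x, ENNReal.ofReal (f x) * h x := by
  rw [pdfMeasure, lintegral_withDensity_eq_lintegral_mul_non_measurable _
    hf.measurable.ennreal_ofReal (Filter.Eventually.of_forall fun x => ENNReal.ofReal_lt_top)]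
  rfl

/-- Density of the samples of a sequence of type `b`. -/
def dens (f₀ f₁ : ℝ → ℝ) (b : Bool) : ℝ → ℝ := if b = true then f₁ else f₀

/-- Prior weight of the type `b`. -/
def typeWeight (π₀ : ℝ) (b : Bool) : ℝ := if b = true then π₀ else 1 - π₀

lemma isPdf_dens {f₀ f₁ : ℝ → ℝ} (hf₀ : IsPdf f₀) (hf₁ : IsPdf f₁) (b : Bool) :
    IsPdf (dens f₀ f₁ b) := by
  cases b <;> simpa [dens]

lemma typeWeight_nonneg {π₀ : ℝ} (h0 : 0 ≤ π₀) (h1 : π₀ ≤ 1) (b : Bool) :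
    0 ≤ typeWeight π₀ b := by
  cases b <;> simpa [typeWeight]

section Law

variable {f₀ f₁ : ℝ → ℝ} {π₀ : ℝ}

/-- The law of the samples of one sequence of type `b`. -/
def samplesLaw (f₀ f₁ : ℝ → ℝ) (b : Bool) : Measure (ℕ → ℝ) :=
  Measure.infinitePi fun _ : ℕ => pdfMeasure (dens f₀ f₁ b)

lemma isProbabilityMeasure_samplesLaw (hf₀ : IsPdf f₀) (hf₁ : IsPdf f₁) (b : Bool) :
    IsProbabilityMeasure (samplesLaw f₀ f₁ b) := by
  have := (isPdf_dens hf₀ hf₁ b).isProbabilityMeasure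
  unfold samplesLaw
  infer_instance

lemma lintegral_seqLaw (hf₀ : IsPdf f₀) (hf₁ : IsPdf f₁) {F : Bool × (ℕ → ℝ) → ℝ≥0∞}
    (hF : Measurable F) :
    ∫⁻ σ, F σ ∂seqLaw f₀ f₁ π₀ =
      ∑ b, ENNReal.ofReal (typeWeight π₀ b) * ∫⁻ y, F (b, y) ∂samplesLaw f₀ f₁ b := by
  have h0 := isProbabilityMeasure_samplesLaw hf₀ hf₁ false
  have h1 := isProbabilityMeasure_samplesLaw hf₀ hf₁ true
  have e : seqLaw f₀ f₁ π₀ =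
      ENNReal.ofReal (1 - π₀) • (Measure.dirac false).prod (samplesLaw f₀ f₁ false) +
      ENNReal.ofReal π₀ • (Measure.dirac true).prod (samplesLaw f₀ f₁ true) := rfl
  rw [e, lintegral_add_measure, lintegral_smul_measure, lintegral_smul_measure,
    lintegral_prod _ hF.aemeasurable, lintegral_prod _ hF.aemeasurable,
    lintegral_dirac, lintegral_dirac, Fintype.sum_bool, add_comm]
  simp [typeWeight]

lemma isProbabilityMeasure_seqLaw (hf₀ : IsPdf f₀) (hf₁ : IsPdf f₁) (h0 : 0 ≤ π₀) (h1 : π₀ ≤ 1) :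
    IsProbabilityMeasure (seqLaw f₀ f₁ π₀) := by
  have h2 := isProbabilityMeasure_samplesLaw hf₀ hf₁
  constructor
  have := lintegral_seqLaw (π₀ := π₀) hf₀ hf₁ (F := fun _ => 1) measurable_const
  simp only [lintegral_one, measure_univ, Fintype.sum_bool, mul_one] at this
  rw [this, ← ENNReal.ofReal_add (typeWeight_nonneg h0 h1 _) (typeWeight_nonneg h0 h1 _)]
  simp [typeWeight]

lemma isProbabilityMeasure_law (hf₀ : IsPdf f₀) (hf₁ : IsPdf f₁) (h0 : 0 ≤ π₀) (h1 : π₀ ≤ 1) :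
    IsProbabilityMeasure (law f₀ f₁ π₀) := by
  have := isProbabilityMeasure_seqLaw hf₀ hf₁ h0 h1
  unfold law
  infer_instance

/-- Replace the sample of the sequence `s` at time `n`. -/
def setSample (s n : ℕ) (ω : Space) (x : ℝ) : Space :=
  Function.update ω s ((ω s).1, Function.update (ω s).2 n x)

lemma measurable_setSample (s n : ℕ) :
    Measurable fun p : Space × ℝ => setSample s n p.1 p.2 := by
  have h1 : Measurable fun p : Space × ℝ => ((p.1 s).2, p.2) := by fun_prop
  have h2 : Measurable fun p : Space × ℝ =>
      (p.1, ((p.1 s).1, Function.update (p.1 s).2 n p.2)) := by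
    refine measurable_fst.prodMk (Measurable.prodMk (by fun_prop) ?_)
    exact (measurable_update_pair (E := fun _ : ℕ => ℝ) n).comp h1
  exact (measurable_update_pair (E := fun _ : ℕ => Bool × (ℕ → ℝ)) s).comp h2

@[simp] lemma H_setSample (s n r : ℕ) (ω : Space) (x : ℝ) : H r (setSample s n ω x) = H r ω := by
  by_cases h : r = s
  · subst h
    simp [H, setSample]
  · simp [H, setSample, h]

@[simp] lemma Y_setSample_self (s n : ℕ) (ω : Space) (x : ℝ) : Y s n (setSample s n ω x) = x := by
  simp [Y, setSample]

lemma Y_setSample_of_ne {s n r m : ℕ} (h : r ≠ s ∨ m ≠ n) (ω : Space) (x : ℝ) :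
    Y r m (setSample s n ω x) = Y r m ω := by
  by_cases hr : r = s
  · subst hr
    have hm : m ≠ n := by tauto
    simp [Y, setSample, hm]
  · simp [Y, setSample, hr]

/-- The measure varies with `a` but takes only two values, so a case split replaces an argument with
kernels. -/
lemma measurable_lintegral_dens (hf₀ : IsPdf f₀) (hf₁ : IsPdf f₁) {α : Type*} [MeasurableSpace α]
    {b : α → Bool} (hb : Measurable b) {F : α × ℝ → ℝ≥0∞} (hF : Measurable F) :
    Measurable fun a => ∫⁻ x, F (a, x) ∂pdfMeasure (dens f₀ f₁ (b a)) := by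
  have h0 := (isPdf_dens hf₀ hf₁)
  have h (a : α) : ∫⁻ x, F (a, x) ∂pdfMeasure (dens f₀ f₁ (b a)) =
      if b a = true then ∫⁻ x, F (a, x) ∂pdfMeasure (dens f₀ f₁ true)
      else ∫⁻ x, F (a, x) ∂pdfMeasure (dens f₀ f₁ false) := by
    cases b a <;> simp
  simp only [h]
  have := (h0 true).isProbabilityMeasure
  have := (h0 false).isProbabilityMeasure
  exact Measurable.ite (hb (measurableSet_singleton true)) hF.lintegral_prod_right'
    hF.lintegral_prod_right'

lemma lintegral_seqLaw_update (hf₀ : IsPdf f₀) (hf₁ : IsPdf f₁) (n : ℕ)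
    {F : Bool × (ℕ → ℝ) → ℝ≥0∞} (hF : Measurable F) :
    ∫⁻ σ, F σ ∂seqLaw f₀ f₁ π₀ =
      ∫⁻ σ, ∫⁻ x, F (σ.1, Function.update σ.2 n x) ∂pdfMeasure (dens f₀ f₁ σ.1)
        ∂seqLaw f₀ f₁ π₀ := by
  have h0 := isPdf_dens hf₀ hf₁
  have hF' : Measurable fun p : (Bool × (ℕ → ℝ)) × ℝ => F (p.1.1, Function.update p.1.2 n p.2) := by
    refine hF.comp (Measurable.prodMk (by fun_prop) ?_)
    exact (measurable_update_pair (E := fun _ : ℕ => ℝ) n).comp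
      (f := fun p : (Bool × (ℕ → ℝ)) × ℝ => (p.1.2, p.2)) (by fun_prop)
  rw [lintegral_seqLaw hf₀ hf₁ hF, lintegral_seqLaw hf₀ hf₁
    (measurable_lintegral_dens hf₀ hf₁ measurable_fst hF')]
  refine Finset.sum_congr rfl fun b _ => ?_
  have := (h0 b).isProbabilityMeasure
  rw [samplesLaw, lintegral_infinitePi_update (F := fun y => F (b, y)) _ n
    (hF.comp measurable_prodMk_left)]

lemma measurable_H (s : ℕ) : Measurable (H s) := measurable_fst.comp (measurable_pi_apply s)

/-- Given everything else, the sample of the sequence `s` at time `n` has the density that belongs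
to the type of the sequence. -/
lemma lintegral_law_setSample (hf₀ : IsPdf f₀) (hf₁ : IsPdf f₁) (h0 : 0 ≤ π₀) (h1 : π₀ ≤ 1)
    (s n : ℕ) {F : Space → ℝ≥0∞} (hF : Measurable F) :
    ∫⁻ ω, F ω ∂law f₀ f₁ π₀ =
      ∫⁻ ω, ∫⁻ x, F (setSample s n ω x) ∂pdfMeasure (dens f₀ f₁ (H s ω)) ∂law f₀ f₁ π₀ := by
  have := isProbabilityMeasure_seqLaw hf₀ hf₁ h0 h1
  have hm : Measurable fun ω : Space =>
      ∫⁻ x, F (setSample s n ω x) ∂pdfMeasure (dens f₀ f₁ (H s ω)) :=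
    measurable_lintegral_dens hf₀ hf₁ (measurable_H s) (hF.comp (measurable_setSample s n))
  -- Resampling the whole sequence `s` on both sides reduces the claim to the law of a single
  -- sequence.
  rw [law, lintegral_infinitePi_update (E := fun _ : ℕ => Bool × (ℕ → ℝ)) _ s hF,
    lintegral_infinitePi_update (E := fun _ : ℕ => Bool × (ℕ → ℝ)) _ s hm]
  refine lintegral_congr fun ω => ?_
  rw [lintegral_seqLaw_update hf₀ hf₁ n]
  · simp [setSample, H]
  · exact hF.comp ((measurable_update_pair (E := fun _ : ℕ => Bool × (ℕ → ℝ)) s).comp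
      measurable_prodMk_left)

/-! ### Convolutions of densities -/

lemma measurable_conv {f h : ℝ → ℝ} (hf : IsPdf f) (hh : IsPdf h) : Measurable (conv f h) := by
  have : StronglyMeasurable fun p : ℝ × ℝ => f p.2 * h (p.1 - p.2) :=
    ((hf.measurable.comp measurable_snd).mul
      (hh.measurable.comp (measurable_fst.sub measurable_snd))).stronglyMeasurable
  exact this.integral_prod_right.measurable

lemma conv_nonneg {f h : ℝ → ℝ} (hf : IsPdf f) (hh : IsPdf h) (z : ℝ) : 0 ≤ conv f h z :=
  integral_nonneg fun t => mul_nonneg (hf.nonneg t) (hh.nonneg (z - t))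

lemma conv_comm (f h : ℝ → ℝ) : conv f h = conv h f := by
  have : (ContinuousLinearMap.mul ℝ ℝ).flip = ContinuousLinearMap.mul ℝ ℝ := by
    ext
    simp
  rw [conv, conv, ← convolution_flip, this]

lemma lintegral_add_pdfMeasure {f h : ℝ → ℝ} (hf : IsPdf f) (hh : IsPdf h) {F : ℝ → ℝ≥0∞}
    (hF : Measurable F) :
    ∫⁻ x, ∫⁻ y, F (x + y) ∂pdfMeasure h ∂pdfMeasure f =
      ∫⁻ z, ENNReal.ofReal (conv f h z) * F z := by
  have hm : Measurable fun p : ℝ × ℝ =>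
      ENNReal.ofReal (f p.1) * (ENNReal.ofReal (h (p.2 - p.1)) * F p.2) :=
    (hf.measurable.comp measurable_fst).ennreal_ofReal.mul
      ((hh.measurable.comp (measurable_snd.sub measurable_fst)).ennreal_ofReal.mul
        (hF.comp measurable_snd))
  calc ∫⁻ x, ∫⁻ y, F (x + y) ∂pdfMeasure h ∂pdfMeasure f
      = ∫⁻ x, ∫⁻ z, ENNReal.ofReal (f x) * (ENNReal.ofReal (h (z - x)) * F z) := by
        rw [hf.lintegral_pdfMeasure]
        refine lintegral_congr fun x => ?_
        rw [hh.lintegral_pdfMeasure, lintegral_const_mul']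
        · rw [← lintegral_sub_right_eq_self _ x]
          simp
        · exact ENNReal.ofReal_ne_top
    _ = ∫⁻ z, ∫⁻ x, ENNReal.ofReal (f x) * (ENNReal.ofReal (h (z - x)) * F z) :=
        lintegral_lintegral_swap hm.aemeasurable
    _ = ∫⁻ z, ENNReal.ofReal (conv f h z) * F z := by
        refine lintegral_congr_ae ?_
        -- `conv` is a Bochner integral, equal to `0` where it diverges; it agrees with the Lebesgue
        -- integral where the convolution exists, that is, almost everywhere.
        have hex := hf.integrable.ae_convolution_exists (ContinuousLinearMap.mul ℝ ℝ)
          hh.integrable (μ := volume) (ν := volume)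
        filter_upwards [hex] with z hz
        have hi : Integrable fun t => f t * h (z - t) := hz
        have : conv f h z = ∫ t, f t * h (z - t) := rfl
        rw [this, ofReal_integral_eq_lintegral_ofReal hi (Filter.Eventually.of_forall fun t =>
          mul_nonneg (hf.nonneg t) (hh.nonneg _)), ← lintegral_mul_const'' _
          hi.aestronglyMeasurable.aemeasurable.ennreal_ofReal]
        refine lintegral_congr fun t => ?_
        rw [ENNReal.ofReal_mul (hf.nonneg t), mul_assoc]

lemma lintegral_conv {f h : ℝ → ℝ} (hf : IsPdf f) (hh : IsPdf h) :
    ∫⁻ z, ENNReal.ofReal (conv f h z) = 1 := by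
  have := hf.isProbabilityMeasure
  have := hh.isProbabilityMeasure
  simpa using (lintegral_add_pdfMeasure hf hh (F := fun _ => 1) measurable_const).symm

end Law

/-! ### Histories -/

/-- The observations up to time `k`, continued by zeros. -/
def hist (φ : ℕ → Space → Bool) (k : ℕ) (ω : Space) : ℕ → ℝ :=
  fun j => if j ≤ k then Z φ j ω else 0

/-- With the σ-algebra generated by a single map, measurability at time `k` becomes factorization
through `hist`. -/
lemma scanFiltration_eq_comap {φ : ℕ → Space → Bool} (hφ : ∀ k, Measurable (φ k)) (k : ℕ) :
    scanFiltration φ hφ k = MeasurableSpace.comap (hist φ k) inferInstance := by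
  have e : scanFiltration φ hφ k = ⨆ j ≤ k, MeasurableSpace.comap (Z φ j) inferInstance := rfl
  refine le_antisymm ?_ ?_
  · rw [e]
    refine iSup₂_le fun j hj => ?_
    have : Z φ j = (fun x : ℕ → ℝ => x j) ∘ hist φ k := by
      ext ω
      simp [hist, hj]
    rw [this, ← MeasurableSpace.comap_comp]
    exact MeasurableSpace.comap_mono (measurable_pi_apply j).comap_le
  · have : Measurable[scanFiltration φ hφ k] (hist φ k) := by
      refine @measurable_pi_lambda Space ℕ (fun _ => ℝ) (scanFiltration φ hφ k) _ _ fun j => ?_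
      by_cases hj : j ≤ k
      · simp only [hist, hj, if_true]
        rw [e]
        exact Measurable.mono (comap_measurable _) (le_iSup₂_of_le j hj le_rfl) le_rfl
      · simp only [hist, hj, if_false]
        exact measurable_const
    exact this.comap_le

lemma hist_succ (φ : ℕ → Space → Bool) (k : ℕ) (ω : Space) :
    hist φ (k + 1) ω = Function.update (hist φ k ω) (k + 1) (Z φ (k + 1) ω) := by
  ext j
  by_cases hj : j = k + 1
  · subst hj
    simp [hist]
  · have : j ≤ k + 1 ↔ j ≤ k := by omega
    simp [hist, Function.update_of_ne hj, this]

lemma hist_zero (φ : ℕ → Space → Bool) (ω : Space) : hist φ 0 ω = 0 := by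
  ext j
  by_cases hj : j = 0
  · subst hj
    simp [hist, Z]
  · simp [hist, hj]

namespace ScanStrategy

variable (S : ScanStrategy)

lemma F_eq_comap (k : ℕ) : S.F k = MeasurableSpace.comap (hist S.φ k) inferInstance :=
  scanFiltration_eq_comap S.measurable_φ k

lemma measurable_hist (k : ℕ) : Measurable (hist S.φ k) := by
  rw [measurable_iff_comap_le, ← S.F_eq_comap]
  exact S.F.le k

/-- Doob–Dynkin factorization. It holds at every point, so equal histories force equal decisions
without exceptional null sets. -/
lemma exists_hist_comp {β : Type*} [MeasurableSpace β] [StandardBorelSpace β] [Nonempty β]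
    {g : Space → β} {k : ℕ} (hg : Measurable[S.F k] g) :
    ∃ h : (ℕ → ℝ) → β, Measurable h ∧ ∀ ω, g ω = h (hist S.φ k ω) := by
  rw [S.F_eq_comap] at hg
  obtain ⟨h, hm, hh⟩ := hg.exists_eq_measurable_comp
  exact ⟨h, hm, fun ω => congrFun hh ω⟩

lemma measurable_hist_comp {β : Type*} [MeasurableSpace β] {h : (ℕ → ℝ) → β} (hh : Measurable h)
    (k : ℕ) : Measurable[S.F k] fun ω => h (hist S.φ k ω) := by
  rw [S.F_eq_comap]
  exact hh.comp (comap_measurable _)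

lemma measurable_Z_F (k : ℕ) : Measurable[S.F k] (Z S.φ k) := by
  have : Z S.φ k = fun ω => (fun x : ℕ → ℝ => x k) (hist S.φ k ω) := by
    ext ω
    simp [hist]
  rw [this]
  exact S.measurable_hist_comp (measurable_pi_apply k) k

lemma φ_eq_of_hist_eq {k : ℕ} {ω ω' : Space} (h : hist S.φ k ω' = hist S.φ k ω) :
    S.φ k ω' = S.φ k ω := by
  obtain ⟨g, -, hg⟩ := S.exists_hist_comp (S.adapted_φ k)
  rw [hg, hg, h]

/-- The observations up to time `k` depend only on the samples that were looked at. -/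
lemma hist_eq_of_samples_eq {ω ω' : Space} {k : ℕ}
    (h : ∀ j ≤ k, Y (seqOne S.φ j ω) j ω' = Y (seqOne S.φ j ω) j ω ∧
      Y (seqTwo S.φ j ω) j ω' = Y (seqTwo S.φ j ω) j ω) :
    hist S.φ k ω' = hist S.φ k ω ∧ pairIdx S.φ (k + 1) ω' = pairIdx S.φ (k + 1) ω := by
  -- Both conclusions must be carried together: equal histories give equal decisions, hence the same
  -- next pair, hence equal next observations.
  induction k with
  | zero =>
    have h0 : hist S.φ 0 ω' = hist S.φ 0 ω := by simp [hist_zero]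
    exact ⟨h0, by simp [pairIdx, S.φ_eq_of_hist_eq h0]⟩
  | succ k ih =>
    obtain ⟨ih1, ih2⟩ := ih fun j hj => h j (by omega)
    have h1 : hist S.φ (k + 1) ω' = hist S.φ (k + 1) ω := by
      obtain ⟨ha, hb⟩ := h (k + 1) le_rfl
      rw [hist_succ, hist_succ, ih1]
      congr 1
      simp only [Z, seqOne, seqTwo] at ha hb ⊢
      rw [ih2, ha, hb]
    refine ⟨h1, ?_⟩
    rw [pairIdx, ih2, S.φ_eq_of_hist_eq h1, ← pairIdx]

lemma hist_setSample {k n s : ℕ} (h : k < n) (ω : Space) (x : ℝ) :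
    hist S.φ k (setSample s n ω x) = hist S.φ k ω ∧
      pairIdx S.φ (k + 1) (setSample s n ω x) = pairIdx S.φ (k + 1) ω :=
  S.hist_eq_of_samples_eq fun j hj =>
    ⟨Y_setSample_of_ne (Or.inr (by omega)) ω x, Y_setSample_of_ne (Or.inr (by omega)) ω x⟩

lemma pairIdx_mono (ω : Space) : Monotone fun k => pairIdx S.φ k ω :=
  monotone_nat_of_le_succ fun k => by simp [pairIdx]

/-- A switch at time `k` to the pair `m` does not depend on the sequences `s ≥ 2 m`. -/
lemma hist_update {k m s : ℕ} (hs : 2 * m ≤ s) {ω : Space} (σ : Bool × (ℕ → ℝ))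
    (hm : S.φ k ω = true ∧ pairIdx S.φ (k + 1) ω = m) :
    hist S.φ k (Function.update ω s σ) = hist S.φ k ω ∧
      S.φ k (Function.update ω s σ) = true ∧
      pairIdx S.φ (k + 1) (Function.update ω s σ) = m := by
  obtain ⟨h1, rfl⟩ := hm
  have key := S.hist_eq_of_samples_eq (ω := ω) (ω' := Function.update ω s σ) (k := k)
    fun j hj => by
      have h2 : pairIdx S.φ j ω ≤ pairIdx S.φ k ω := S.pairIdx_mono ω hj
      -- The switch at time `k` puts every pair seen so far strictly below `m`, so its sequences
      -- have numbers less than `2 * m ≤ s`.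
      have h3 : pairIdx S.φ (k + 1) ω = pairIdx S.φ k ω + 1 := by simp [pairIdx, h1]
      have h4 : 2 * pairIdx S.φ j ω ≠ s := by omega
      have h5 : 2 * pairIdx S.φ j ω + 1 ≠ s := by omega
      simp [Y, seqOne, seqTwo, h4, h5]
  exact ⟨key.1, (S.φ_eq_of_hist_eq key.1).trans h1, key.2⟩

/-- The types of the two sequences observed at time `k`. -/
def curType (k : ℕ) (ω : Space) : Bool × Bool := (H (seqOne S.φ k ω) ω, H (seqTwo S.φ k ω) ω)

lemma measurable_curType (k : ℕ) : Measurable (S.curType k) := by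
  have h : ∀ g : ℕ → ℕ, Measurable fun ω => H (g (pairIdx S.φ k ω)) ω := fun g =>
    (measurable_from_prod_countable_right (f := fun x : ℕ × Space => H (g x.1) x.2)
      fun n => measurable_H (g n)).comp ((measurable_pairIdx S.measurable_φ k).prodMk measurable_id)
  exact (h fun n => 2 * n).prodMk (h fun n => 2 * n + 1)

lemma curType_succ_of_false {k : ℕ} {ω : Space} (h : S.φ k ω = false) :
    S.curType (k + 1) ω = S.curType k ω := by
  simp [curType, seqOne, seqTwo, pairIdx, h]

end ScanStrategy

/-! ### Conditional laws -/

/-- Applied to `pairIdx`, this turns the random numbers of the observed sequences into constants;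
applied to a stopping time, it fixes the time. -/
lemma lintegral_congr_of_fibers {α : Type*} [MeasurableSpace α] {μ : Measure α} {n : α → ℕ}
    (hn : Measurable n) {F G : α → ℝ≥0∞} (hF : Measurable F) (hG : Measurable G)
    (h : ∀ m, ∫⁻ ω, (if n ω = m then F ω else 0) ∂μ = ∫⁻ ω, (if n ω = m then G ω else 0) ∂μ) :
    ∫⁻ ω, F ω ∂μ = ∫⁻ ω, G ω ∂μ := by
  have key (K : α → ℝ≥0∞) (hK : Measurable K) :
      ∫⁻ ω, K ω ∂μ = ∑' m, ∫⁻ ω, (if n ω = m then K ω else 0) ∂μ := by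
    have hm (m : ℕ) : Measurable fun ω => if n ω = m then K ω else 0 :=
      hK.ite (hn (measurableSet_singleton m)) measurable_const
    rw [← lintegral_tsum fun m => (hm m).aemeasurable]
    refine lintegral_congr fun ω => ?_
    rw [tsum_eq_single (n ω) (by intro m hm; simp [hm.symm])]
    simp
  rw [key F hF, key G hG]
  exact tsum_congr h

/-- Density of a sample of the sum of two sequences of the types `b`. -/
def pairDens (f₀ f₁ : ℝ → ℝ) (b : Bool × Bool) : ℝ → ℝ :=
  conv (dens f₀ f₁ b.1) (dens f₀ f₁ b.2)

section Laws

variable {f₀ f₁ : ℝ → ℝ} {π₀ : ℝ}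

lemma measurable_pairDens (hf₀ : IsPdf f₀) (hf₁ : IsPdf f₁) (b : Bool × Bool) :
    Measurable (pairDens f₀ f₁ b) :=
  measurable_conv (isPdf_dens hf₀ hf₁ _) (isPdf_dens hf₀ hf₁ _)

lemma pairDens_nonneg (hf₀ : IsPdf f₀) (hf₁ : IsPdf f₁) (b : Bool × Bool) (z : ℝ) :
    0 ≤ pairDens f₀ f₁ b z :=
  conv_nonneg (isPdf_dens hf₀ hf₁ _) (isPdf_dens hf₀ hf₁ _) z

lemma measurable_lintegral_pairDens (hf₀ : IsPdf f₀) (hf₁ : IsPdf f₁) {α : Type*}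
    [MeasurableSpace α] {ψ : α × (Bool × Bool) × ℝ → ℝ≥0∞} (hψ : Measurable ψ) :
    Measurable fun p : α × (Bool × Bool) =>
      ∫⁻ z, ENNReal.ofReal (pairDens f₀ f₁ p.2 z) * ψ (p.1, p.2, z) := by
  refine measurable_from_prod_countable_left fun b => ?_
  have : Measurable fun q : α × ℝ => ENNReal.ofReal (pairDens f₀ f₁ b q.2) * ψ (q.1, b, q.2) :=
    ((measurable_pairDens hf₀ hf₁ b).comp measurable_snd).ennreal_ofReal.mul
      (hψ.comp (by fun_prop))
  exact this.lintegral_prod_right'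

/-- Given everything else, the sum of the samples of two sequences at time `n` has the density that
belongs to the types of the two sequences. -/
lemma lintegral_sum_samples (hf₀ : IsPdf f₀) (hf₁ : IsPdf f₁) (h0 : 0 ≤ π₀) (h1 : π₀ ≤ 1)
    {s t n : ℕ} (hst : s ≠ t) {C : Space × ℝ → ℝ≥0∞} (hC : Measurable C)
    (hs : ∀ ω x z, C (setSample s n ω x, z) = C (ω, z))
    (ht : ∀ ω x z, C (setSample t n ω x, z) = C (ω, z)) :
    ∫⁻ ω, C (ω, Y s n ω + Y t n ω) ∂law f₀ f₁ π₀ =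
      ∫⁻ ω, (∫⁻ z, ENNReal.ofReal (pairDens f₀ f₁ (H s ω, H t ω) z) * C (ω, z))
        ∂law f₀ f₁ π₀ := by
  have hF : Measurable fun ω => C (ω, Y s n ω + Y t n ω) :=
    hC.comp (measurable_id.prodMk ((measurable_Y s n).add (measurable_Y t n)))
  have hF' : Measurable fun ω : Space => ∫⁻ x, C (setSample t n ω x,
      Y s n (setSample t n ω x) + Y t n (setSample t n ω x)) ∂pdfMeasure (dens f₀ f₁ (H t ω)) :=
    measurable_lintegral_dens hf₀ hf₁ (measurable_H _) (hF.comp (measurable_setSample t n))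
  rw [lintegral_law_setSample hf₀ hf₁ h0 h1 t n hF, lintegral_law_setSample hf₀ hf₁ h0 h1 s n hF']
  refine lintegral_congr fun ω => ?_
  have hY (x y : ℝ) : Y s n (setSample t n (setSample s n ω y) x) = y := by
    rw [Y_setSample_of_ne (Or.inl hst), Y_setSample_self]
  simp only [hs, ht, H_setSample, Y_setSample_self, hY]
  exact lintegral_add_pdfMeasure (isPdf_dens hf₀ hf₁ (H s ω)) (isPdf_dens hf₀ hf₁ (H t ω))
    (hC.comp measurable_prodMk_left)

/-- Given the past and the types of the current sequences, the next mixed observation has the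
density that belongs to these types. -/
lemma lintegral_next_obs (hf₀ : IsPdf f₀) (hf₁ : IsPdf f₁) (h0 : 0 ≤ π₀) (h1 : π₀ ≤ 1)
    (S : ScanStrategy) (k : ℕ) {ψ : (ℕ → ℝ) × (Bool × Bool) × ℝ → ℝ≥0∞} (hψ : Measurable ψ) :
    ∫⁻ ω, ψ (hist S.φ k ω, S.curType (k + 1) ω, Z S.φ (k + 1) ω) ∂law f₀ f₁ π₀ =
      ∫⁻ ω, (∫⁻ z, ENNReal.ofReal (pairDens f₀ f₁ (S.curType (k + 1) ω) z) *
        ψ (hist S.φ k ω, S.curType (k + 1) ω, z)) ∂law f₀ f₁ π₀ := by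
  have hh := S.measurable_hist k
  have hT := S.measurable_curType (k + 1)
  have hZ := measurable_Z S.measurable_φ (k + 1)
  have hI := measurable_pairIdx S.measurable_φ (k + 1)
  have hm1 : Measurable fun ω => ψ (hist S.φ k ω, S.curType (k + 1) ω, Z S.φ (k + 1) ω) :=
    hψ.comp (hh.prodMk (hT.prodMk hZ))
  have hm2 := (measurable_lintegral_pairDens hf₀ hf₁ hψ).comp (hh.prodMk hT)
  refine lintegral_congr_of_fibers hI hm1 hm2 fun m => ?_
  -- On the fiber the pair is the deterministic one `2 * m`, `2 * m + 1`. The cut-off itself is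
  -- insensitive to samples at time `k + 1`, since the pair number is settled by the history up to
  -- `k`.
  set C : Space × ℝ → ℝ≥0∞ := fun p => if pairIdx S.φ (k + 1) p.1 = m then
    ψ (hist S.φ k p.1, (H (2 * m) p.1, H (2 * m + 1) p.1), p.2) else 0 with hCdef
  have hC : Measurable C := by
    refine Measurable.ite (measurable_fst (hI (measurableSet_singleton m))) (hψ.comp ?_)
      measurable_const
    exact (hh.comp measurable_fst).prodMk ((((measurable_H _).comp measurable_fst).prodMk
      ((measurable_H _).comp measurable_fst)).prodMk measurable_snd)
  have hinv (s : ℕ) (ω : Space) (x z : ℝ) : C (setSample s (k + 1) ω x, z) = C (ω, z) := by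
    obtain ⟨h2, h3⟩ := S.hist_setSample (s := s) (Nat.lt_succ_self k) ω x
    simp only [hCdef, h2, h3, H_setSample]
  refine Eq.trans (lintegral_congr fun ω => ?_) ((lintegral_sum_samples hf₀ hf₁ h0 h1
    (s := 2 * m) (t := 2 * m + 1) (by omega) hC (hinv _) (hinv _)).trans
    (lintegral_congr fun ω => ?_))
  · by_cases h : pairIdx S.φ (k + 1) ω = m
    · subst h
      simp only [hCdef, if_true, ScanStrategy.curType, Z, seqOne, seqTwo]
    · simp only [hCdef, h, if_false]
  · by_cases h : pairIdx S.φ (k + 1) ω = m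
    · subst h
      simp only [hCdef, if_true, ScanStrategy.curType, seqOne, seqTwo]
    · simp only [hCdef, h, if_false, mul_zero, lintegral_const, zero_mul]

/-- The types of a pair of sequences are independent of everything that does not involve these
sequences. -/
lemma lintegral_types (hf₀ : IsPdf f₀) (hf₁ : IsPdf f₁) (h0 : 0 ≤ π₀) (h1 : π₀ ≤ 1) (m : ℕ)
    {B : Space × (Bool × Bool) → ℝ≥0∞} (hB : Measurable B)
    (hinv : ∀ ω b, ∀ s ≥ 2 * m, ∀ σ, B (Function.update ω s σ, b) = B (ω, b)) :
    ∫⁻ ω, B (ω, (H (2 * m) ω, H (2 * m + 1) ω)) ∂law f₀ f₁ π₀ =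
      ∫⁻ ω, ∑ b : Bool × Bool, ENNReal.ofReal (typeWeight π₀ b.1 * typeWeight π₀ b.2) * B (ω, b)
        ∂law f₀ f₁ π₀ := by
  have := isProbabilityMeasure_seqLaw hf₀ hf₁ h0 h1
  have hs := isProbabilityMeasure_samplesLaw hf₀ hf₁
  have hF : Measurable fun ω : Space => B (ω, (H (2 * m) ω, H (2 * m + 1) ω)) :=
    hB.comp (measurable_id.prodMk ((measurable_H _).prodMk (measurable_H _)))
  have e1 (ω : Space) : ∫⁻ σ, B (Function.update ω (2 * m + 1) σ,
      (H (2 * m) (Function.update ω (2 * m + 1) σ),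
        H (2 * m + 1) (Function.update ω (2 * m + 1) σ))) ∂seqLaw f₀ f₁ π₀ =
      ∑ b, ENNReal.ofReal (typeWeight π₀ b) * B (ω, (H (2 * m) ω, b)) := by
    have : ∀ σ : Bool × (ℕ → ℝ), B (Function.update ω (2 * m + 1) σ,
      (H (2 * m) (Function.update ω (2 * m + 1) σ),
        H (2 * m + 1) (Function.update ω (2 * m + 1) σ))) = B (ω, (H (2 * m) ω, σ.1)) := fun σ => by
      rw [hinv _ _ _ (by omega)]
      simp [H]
    simp only [this]
    have hm : Measurable fun σ : Bool × (ℕ → ℝ) => B (ω, (H (2 * m) ω, σ.1)) := by fun_prop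
    rw [lintegral_seqLaw hf₀ hf₁ hm]
    simp
  have hG : Measurable fun ω : Space =>
      ∑ b, ENNReal.ofReal (typeWeight π₀ b) * B (ω, (H (2 * m) ω, b)) := by
    refine Finset.measurable_sum _ fun b _ => Measurable.const_mul (hB.comp ?_) _
    exact measurable_id.prodMk ((measurable_H _).prodMk measurable_const)
  -- The two sequences are resampled one after the other. By `hinv` the first argument of `B` does
  -- not react, so only the two independent types are averaged.
  rw [law, lintegral_infinitePi_update (E := fun _ : ℕ => Bool × (ℕ → ℝ)) _ (2 * m + 1) hF]
  simp only [e1]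
  rw [lintegral_infinitePi_update (E := fun _ : ℕ => Bool × (ℕ → ℝ)) _ (2 * m) hG]
  refine lintegral_congr fun ω => ?_
  simp only [hinv ω _ (2 * m) le_rfl]
  have e2 (σ : Bool × (ℕ → ℝ)) : H (2 * m) (Function.update ω (2 * m) σ) = σ.1 := by simp [H]
  simp only [e2]
  have hm : Measurable fun σ : Bool × (ℕ → ℝ) =>
      ∑ b, ENNReal.ofReal (typeWeight π₀ b) * B (ω, (σ.1, b)) := by fun_prop
  rw [lintegral_seqLaw hf₀ hf₁ hm]
  simp only [lintegral_const, measure_univ, mul_one, Fintype.sum_prod_type, Finset.mul_sum,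
    ← mul_assoc]
  simp only [ENNReal.ofReal_mul (typeWeight_nonneg h0 h1 _)]

lemma initialWeights_prior (b : Bool × Bool) :
    initialWeights (prior π₀) b = typeWeight π₀ b.1 * typeWeight π₀ b.2 := by
  rcases b with ⟨_ | _, _ | _⟩ <;> simp [initialWeights, prior, typeWeight] <;> ring

/-- After a switch to the pair `m` the history involves only sequences below `2 * m`, so the types
of the new pair still have their prior law given that history. -/
lemma lintegral_curType_of_switch (hf₀ : IsPdf f₀) (hf₁ : IsPdf f₁) (h0 : 0 ≤ π₀) (h1 : π₀ ≤ 1)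
    (S : ScanStrategy) (k : ℕ) {G : (ℕ → ℝ) × (Bool × Bool) → ℝ≥0∞} (hG : Measurable G) :
    ∫⁻ ω, (if S.φ k ω = true then G (hist S.φ k ω, S.curType (k + 1) ω) else 0) ∂law f₀ f₁ π₀ =
      ∫⁻ ω, (if S.φ k ω = true then
        ∑ b, ENNReal.ofReal (initialWeights (prior π₀) b) * G (hist S.φ k ω, b) else 0)
          ∂law f₀ f₁ π₀ := by
  have hh := S.measurable_hist k
  have hT := S.measurable_curType (k + 1)
  have hI := measurable_pairIdx S.measurable_φ (k + 1)
  have hφ := S.measurable_φ k (measurableSet_singleton true)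
  refine lintegral_congr_of_fibers hI (.ite hφ (hG.comp (hh.prodMk hT)) measurable_const)
    (.ite hφ (Finset.measurable_sum _ fun b _ => Measurable.const_mul
      (hG.comp (hh.prodMk measurable_const)) _) measurable_const) fun m => ?_
  set B : Space × (Bool × Bool) → ℝ≥0∞ := fun p =>
    if S.φ k p.1 = true ∧ pairIdx S.φ (k + 1) p.1 = m then G (hist S.φ k p.1, p.2) else 0 with hBdef
  have hB : Measurable B := by
    refine Measurable.ite ?_ (hG.comp ((hh.comp measurable_fst).prodMk measurable_snd))
      measurable_const
    exact measurable_fst (hφ.inter (hI (measurableSet_singleton m)))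
  have hinv : ∀ ω b, ∀ s ≥ 2 * m, ∀ σ, B (Function.update ω s σ, b) = B (ω, b) := by
    intro ω b s hs σ
    by_cases h : S.φ k ω = true ∧ pairIdx S.φ (k + 1) ω = m
    · obtain ⟨h2, h3, h4⟩ := S.hist_update hs σ h
      simp [hBdef, h, h2, h3, h4]
    -- The event must be invariant in both directions: if the modified point were in it, restoring
    -- the original sequence would put `ω` in it as well.
    · have h' : ¬ (S.φ k (Function.update ω s σ) = true ∧
          pairIdx S.φ (k + 1) (Function.update ω s σ) = m) := fun h' => h <| by
        have := (S.hist_update hs (ω s) h').2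
        rwa [Function.update_idem, Function.update_eq_self] at this
      simp only [hBdef, h, h', if_false]
  have key := lintegral_types hf₀ hf₁ h0 h1 m hB hinv
  refine Eq.trans (lintegral_congr fun ω => ?_) (key.trans (lintegral_congr fun ω => ?_))
  · by_cases h : pairIdx S.φ (k + 1) ω = m <;>
      simp [hBdef, h, ScanStrategy.curType, seqOne, seqTwo]
  · by_cases h : pairIdx S.φ (k + 1) ω = m <;> by_cases h' : S.φ k ω = true <;>
      simp [hBdef, h, h', initialWeights_prior]

end Laws

/-! ### The Bayes update -/

section Bayes

variable {f₀ f₁ : ℝ → ℝ} {π₀ : ℝ}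

lemma initialWeights_nonneg {p : ℝ × ℝ} (hp : p ∈ simplex) (b : Bool × Bool) :
    0 ≤ initialWeights p b := by
  obtain ⟨h1, h2, h3⟩ := hp
  rcases b with ⟨_ | _, _ | _⟩ <;> simp only [initialWeights] <;> linarith

lemma measurable_initialWeights (b : Bool × Bool) : Measurable fun p => initialWeights p b := by
  rcases b with ⟨_ | _, _ | _⟩ <;> simp only [initialWeights] <;> fun_prop

lemma prior_mem_simplex (h0 : 0 ≤ π₀) (h1 : π₀ ≤ 1) : prior π₀ ∈ simplex :=
  ⟨by simp only [prior]; positivity, mul_nonneg (by linarith) (by linarith), by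
    simp only [prior]
    nlinarith [sq_nonneg (1 - π₀)]⟩

lemma sum_initialWeights_mul_pairDens (p : ℝ × ℝ) (z : ℝ) :
    ∑ b, initialWeights p b * pairDens f₀ f₁ b z = mixDensity f₀ f₁ p z := by
  simp only [Fintype.sum_prod_type, Fintype.sum_bool, initialWeights, pairDens, dens, mixDensity,
    if_true, Bool.false_eq_true, if_false, conv_comm f₁ f₀]
  ring

lemma mixDensity_nonneg (hf₀ : IsPdf f₀) (hf₁ : IsPdf f₁) {p : ℝ × ℝ} (hp : p ∈ simplex) (z : ℝ) :
    0 ≤ mixDensity f₀ f₁ p z := by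
  rw [← sum_initialWeights_mul_pairDens]
  exact Finset.sum_nonneg fun b _ =>
    mul_nonneg (initialWeights_nonneg hp b) (pairDens_nonneg hf₀ hf₁ b z)

lemma measurable_mixDensity (hf₀ : IsPdf f₀) (hf₁ : IsPdf f₁) :
    Measurable fun q : (ℝ × ℝ) × ℝ => mixDensity f₀ f₁ q.1 q.2 := by
  have h0 := measurable_conv hf₀ hf₀
  have h1 := measurable_conv hf₀ hf₁
  have h2 := measurable_conv hf₁ hf₁
  unfold mixDensity
  fun_prop

lemma measurable_bayes (hf₀ : IsPdf f₀) (hf₁ : IsPdf f₁) :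
    Measurable fun q : (ℝ × ℝ) × ℝ => bayes f₀ f₁ q.1 q.2 := by
  have h1 := measurable_conv hf₀ hf₁
  have h2 := measurable_conv hf₁ hf₁
  have h3 := measurable_mixDensity hf₀ hf₁
  unfold bayes
  fun_prop

/-- No positivity of the denominator is required: where it vanishes the update is `(0, 0)`, which
still lies in the simplex. -/
lemma bayes_mem_simplex (hf₀ : IsPdf f₀) (hf₁ : IsPdf f₁) {p : ℝ × ℝ} (hp : p ∈ simplex) (z : ℝ) :
    bayes f₀ f₁ p z ∈ simplex := by
  have h := mixDensity_nonneg hf₀ hf₁ hp z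
  have h0 := mul_nonneg (sub_nonneg.2 hp.2.2) (conv_nonneg hf₀ hf₀ z)
  have h1 := mul_nonneg hp.2.1 (conv_nonneg hf₀ hf₁ z)
  have h2 := mul_nonneg hp.1 (conv_nonneg hf₁ hf₁ z)
  refine ⟨div_nonneg h2 h, div_nonneg h1 h, ?_⟩
  simp only [bayes]
  rw [← add_div]
  refine div_le_one_of_le₀ ?_ h
  simp only [mixDensity]
  nlinarith

/-- Bayes' formula in product form, so that it survives a vanishing denominator: a zero sum of
nonnegative terms has only zero terms. -/
lemma mixDensity_mul_initialWeights_bayes (hf₀ : IsPdf f₀) (hf₁ : IsPdf f₁) {p : ℝ × ℝ}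
    (hp : p ∈ simplex) (z : ℝ) (b : Bool × Bool) :
    mixDensity f₀ f₁ p z * initialWeights (bayes f₀ f₁ p z) b =
      initialWeights p b * pairDens f₀ f₁ b z := by
  by_cases h : mixDensity f₀ f₁ p z = 0
  · have := sum_initialWeights_mul_pairDens (f₀ := f₀) (f₁ := f₁) p z
    rw [h, Finset.sum_eq_zero_iff_of_nonneg fun b _ =>
      mul_nonneg (initialWeights_nonneg hp b) (pairDens_nonneg hf₀ hf₁ b z)] at this
    rw [h, this b (Finset.mem_univ b), zero_mul]
  · rcases b with ⟨_ | _, _ | _⟩ <;>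
      simp only [initialWeights, bayes, pairDens, dens, if_true, Bool.false_eq_true, if_false,
        conv_comm f₁ f₀] <;> field_simp
    simp only [mixDensity]
    ring

/-- The joint law of types and observation, disintegrated in the two orders: types and then
observation, or observation and then posterior types. -/
lemma lintegral_mixDensity (hf₀ : IsPdf f₀) (hf₁ : IsPdf f₁) {p : ℝ × ℝ} (hp : p ∈ simplex)
    (F : (Bool × Bool) → ℝ → ℝ≥0∞) (hF : ∀ b, Measurable (F b)) :
    ∑ b, ENNReal.ofReal (initialWeights p b) *
        ∫⁻ z, ENNReal.ofReal (pairDens f₀ f₁ b z) * F b z =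
      ∫⁻ z, ENNReal.ofReal (mixDensity f₀ f₁ p z) *
        ∑ b, ENNReal.ofReal (initialWeights (bayes f₀ f₁ p z) b) * F b z := by
  have hm (b : Bool × Bool) : Measurable fun z => ENNReal.ofReal (pairDens f₀ f₁ b z) * F b z :=
    (measurable_pairDens hf₀ hf₁ b).ennreal_ofReal.mul (hF b)
  simp only [← lintegral_const_mul _ (hm _)]
  rw [← lintegral_finsetSum _ fun b _ => (hm b).const_mul _]
  refine lintegral_congr fun z => ?_
  rw [Finset.mul_sum]
  refine Finset.sum_congr rfl fun b _ => ?_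
  rw [← mul_assoc, ← mul_assoc, ← ENNReal.ofReal_mul (initialWeights_nonneg hp b),
    ← ENNReal.ofReal_mul (mixDensity_nonneg hf₀ hf₁ hp z),
    mixDensity_mul_initialWeights_bayes hf₀ hf₁ hp]

lemma sum_ofReal_initialWeights {p : ℝ × ℝ} (hp : p ∈ simplex) :
    ∑ b, ENNReal.ofReal (initialWeights p b) = 1 := by
  rw [← ENNReal.ofReal_sum_of_nonneg fun b _ => initialWeights_nonneg hp b]
  simp only [Fintype.sum_prod_type, Fintype.sum_bool, initialWeights]
  rw [← ENNReal.ofReal_one]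
  congr 1
  ring

lemma lintegral_mixDensity_mul (hf₀ : IsPdf f₀) (hf₁ : IsPdf f₁) {p : ℝ × ℝ} (hp : p ∈ simplex)
    {F : ℝ → ℝ≥0∞} (hF : Measurable F) :
    ∑ b, ENNReal.ofReal (initialWeights p b) *
        ∫⁻ z, ENNReal.ofReal (pairDens f₀ f₁ b z) * F z =
      ∫⁻ z, ENNReal.ofReal (mixDensity f₀ f₁ p z) * F z := by
  rw [lintegral_mixDensity hf₀ hf₁ hp (fun _ => F) fun _ => hF]
  refine lintegral_congr fun z => ?_
  rw [← Finset.sum_mul, sum_ofReal_initialWeights (bayes_mem_simplex hf₀ hf₁ hp z), one_mul]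

lemma lintegral_mixDensity_eq_one (hf₀ : IsPdf f₀) (hf₁ : IsPdf f₁) {p : ℝ × ℝ}
    (hp : p ∈ simplex) : ∫⁻ z, ENNReal.ofReal (mixDensity f₀ f₁ p z) = 1 := by
  have h := lintegral_mixDensity_mul hf₀ hf₁ hp (F := fun _ => 1) measurable_const
  have h' (b : Bool × Bool) : ∫⁻ z, ENNReal.ofReal (pairDens f₀ f₁ b z) = 1 :=
    lintegral_conv (isPdf_dens hf₀ hf₁ _) (isPdf_dens hf₀ hf₁ _)
  simp only [mul_one, h', sum_ofReal_initialWeights hp] at h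
  exact h.symm

end Bayes

/-! ### The posterior probabilities -/

namespace ScanStrategy

variable {f₀ f₁ : ℝ → ℝ} {π₀ : ℝ}

/-- The posterior probabilities, computed by the Bayes rule. -/
def belief (f₀ f₁ : ℝ → ℝ) (π₀ : ℝ) (S : ScanStrategy) : ℕ → Space → ℝ × ℝ
  | 0, _ => prior π₀
  | k + 1, ω => bayes f₀ f₁ (if S.φ k ω = true then prior π₀ else belief f₀ f₁ π₀ S k ω)
      (Z S.φ (k + 1) ω)

/-- The probabilities that govern the observation at time `k + 1`. -/
def nextPrior (f₀ f₁ : ℝ → ℝ) (π₀ : ℝ) (S : ScanStrategy) (k : ℕ) (ω : Space) : ℝ × ℝ :=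
  if S.φ k ω = true then prior π₀ else S.belief f₀ f₁ π₀ k ω

lemma belief_succ (S : ScanStrategy) (k : ℕ) (ω : Space) :
    S.belief f₀ f₁ π₀ (k + 1) ω = bayes f₀ f₁ (S.nextPrior f₀ f₁ π₀ k ω) (Z S.φ (k + 1) ω) := rfl

lemma belief_mem_simplex (hf₀ : IsPdf f₀) (hf₁ : IsPdf f₁) (h0 : 0 ≤ π₀) (h1 : π₀ ≤ 1)
    (S : ScanStrategy) (k : ℕ) (ω : Space) : S.belief f₀ f₁ π₀ k ω ∈ simplex := by
  induction k with
  | zero => exact prior_mem_simplex h0 h1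
  | succ k ih =>
    refine bayes_mem_simplex hf₀ hf₁ ?_ _
    split_ifs
    exacts [prior_mem_simplex h0 h1, ih]

lemma nextPrior_mem_simplex (hf₀ : IsPdf f₀) (hf₁ : IsPdf f₁) (h0 : 0 ≤ π₀) (h1 : π₀ ≤ 1)
    (S : ScanStrategy) (k : ℕ) (ω : Space) : S.nextPrior f₀ f₁ π₀ k ω ∈ simplex := by
  unfold nextPrior
  split_ifs
  exacts [prior_mem_simplex h0 h1, S.belief_mem_simplex hf₀ hf₁ h0 h1 k ω]

lemma measurable_nextPrior_of_belief {S : ScanStrategy} {k : ℕ}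
    (h : Measurable[S.F k] (S.belief f₀ f₁ π₀ k)) :
    Measurable[S.F k] (S.nextPrior f₀ f₁ π₀ k) :=
  Measurable.ite (S.adapted_φ k (measurableSet_singleton true)) measurable_const h

lemma measurable_belief (hf₀ : IsPdf f₀) (hf₁ : IsPdf f₁) (S : ScanStrategy) (k : ℕ) :
    Measurable[S.F k] (S.belief f₀ f₁ π₀ k) := by
  induction k with
  | zero => exact measurable_const
  | succ k ih =>
    have h1 : Measurable[S.F (k + 1)] (S.nextPrior f₀ f₁ π₀ k) :=
      (measurable_nextPrior_of_belief ih).mono (S.F.mono (Nat.le_succ k)) le_rfl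
    exact (measurable_bayes hf₀ hf₁).comp (h1.prodMk (S.measurable_Z_F (k + 1)))

lemma measurable_nextPrior (hf₀ : IsPdf f₀) (hf₁ : IsPdf f₁) (S : ScanStrategy) (k : ℕ) :
    Measurable[S.F k] (S.nextPrior f₀ f₁ π₀ k) :=
  measurable_nextPrior_of_belief (S.measurable_belief hf₀ hf₁ k)

/-- `belief` is the conditional distribution of the current types given the observations. -/
def IsCondLaw (f₀ f₁ : ℝ → ℝ) (π₀ : ℝ) (S : ScanStrategy) (k : ℕ) : Prop :=
  ∀ G : (ℕ → ℝ) × (Bool × Bool) → ℝ≥0∞, Measurable G →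
    ∫⁻ ω, G (hist S.φ k ω, S.curType k ω) ∂law f₀ f₁ π₀ =
      ∫⁻ ω, ∑ b, ENNReal.ofReal (initialWeights (S.belief f₀ f₁ π₀ k ω) b) *
        G (hist S.φ k ω, b) ∂law f₀ f₁ π₀

lemma measurable_sum_weights {p : Space → ℝ × ℝ} (hp : Measurable p) (S : ScanStrategy) (k : ℕ)
    {G : (ℕ → ℝ) × (Bool × Bool) → ℝ≥0∞} (hG : Measurable G) :
    Measurable fun ω => ∑ b, ENNReal.ofReal (initialWeights (p ω) b) * G (hist S.φ k ω, b) :=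
  Finset.measurable_sum _ fun b _ =>
    ((measurable_initialWeights b).comp hp).ennreal_ofReal.mul
      (hG.comp ((S.measurable_hist k).prodMk measurable_const))

/-- On a switch the new types are fresh. Otherwise the types are unchanged, and since the decision
is a function `ϕ` of the history, the integrand cut off by it is still an admissible test function
for `hk`. -/
lemma IsCondLaw.lintegral_curType_succ (hf₀ : IsPdf f₀) (hf₁ : IsPdf f₁) (h0 : 0 ≤ π₀)
    (h1 : π₀ ≤ 1) {S : ScanStrategy} {k : ℕ} (hk : S.IsCondLaw f₀ f₁ π₀ k)
    {G : (ℕ → ℝ) × (Bool × Bool) → ℝ≥0∞} (hG : Measurable G) :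
    ∫⁻ ω, G (hist S.φ k ω, S.curType (k + 1) ω) ∂law f₀ f₁ π₀ =
      ∫⁻ ω, ∑ b, ENNReal.ofReal (initialWeights (S.nextPrior f₀ f₁ π₀ k ω) b) *
        G (hist S.φ k ω, b) ∂law f₀ f₁ π₀ := by
  obtain ⟨ϕ, hϕm, hϕ⟩ := S.exists_hist_comp (S.adapted_φ k)
  have hφ := S.measurable_φ k (measurableSet_singleton true)
  have hsplit (A : Space → ℝ≥0∞) (hA : Measurable A) : ∫⁻ ω, A ω ∂law f₀ f₁ π₀ =
      ∫⁻ ω, (if S.φ k ω = true then A ω else 0) ∂law f₀ f₁ π₀ +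
        ∫⁻ ω, (if S.φ k ω = true then 0 else A ω) ∂law f₀ f₁ π₀ := by
    have hm : Measurable fun ω => if S.φ k ω = true then A ω else 0 :=
      Measurable.ite hφ hA measurable_const
    rw [← lintegral_add_left hm]
    refine lintegral_congr fun ω => ?_
    split_ifs <;> simp
  have hW : Measurable (S.nextPrior f₀ f₁ π₀ k) :=
    (S.measurable_nextPrior hf₀ hf₁ k).mono (S.F.le k) le_rfl
  have hA1 : Measurable fun ω => G (hist S.φ k ω, S.curType (k + 1) ω) :=
    hG.comp ((S.measurable_hist k).prodMk (S.measurable_curType (k + 1)))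
  rw [hsplit _ hA1, hsplit _ (measurable_sum_weights hW S k hG),
    lintegral_curType_of_switch hf₀ hf₁ h0 h1 S k hG]
  congr 1
  · refine lintegral_congr fun ω => ?_
    by_cases h : S.φ k ω = true <;> simp [h, nextPrior]
  · have hG' : Measurable fun q : (ℕ → ℝ) × (Bool × Bool) => if ϕ q.1 = true then 0 else G q :=
      Measurable.ite (measurable_fst (hϕm (measurableSet_singleton true))) measurable_const hG
    refine Eq.trans (lintegral_congr fun ω => ?_) ((hk _ hG').trans (lintegral_congr fun ω => ?_))
    · by_cases h : S.φ k ω = true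
      · simp [← hϕ, h]
      · simp [← hϕ, h, S.curType_succ_of_false (Bool.not_eq_true _ ▸ h)]
    · by_cases h : S.φ k ω = true <;> simp [← hϕ, h, nextPrior]

lemma IsCondLaw.lintegral_next (hf₀ : IsPdf f₀) (hf₁ : IsPdf f₁) (h0 : 0 ≤ π₀)
    (h1 : π₀ ≤ 1) {S : ScanStrategy} {k : ℕ} (hk : S.IsCondLaw f₀ f₁ π₀ k)
    {ψ : (ℕ → ℝ) × (Bool × Bool) × ℝ → ℝ≥0∞} (hψ : Measurable ψ) :
    ∫⁻ ω, ψ (hist S.φ k ω, S.curType (k + 1) ω, Z S.φ (k + 1) ω) ∂law f₀ f₁ π₀ =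
      ∫⁻ ω, (∑ b, ENNReal.ofReal (initialWeights (S.nextPrior f₀ f₁ π₀ k ω) b) *
        ∫⁻ z, ENNReal.ofReal (pairDens f₀ f₁ b z) * ψ (hist S.φ k ω, b, z)) ∂law f₀ f₁ π₀ := by
  rw [lintegral_next_obs hf₀ hf₁ h0 h1 S k hψ]
  exact hk.lintegral_curType_succ hf₀ hf₁ h0 h1 (measurable_lintegral_pairDens hf₀ hf₁ hψ)

lemma isCondLaw_zero (hf₀ : IsPdf f₀) (hf₁ : IsPdf f₁) (h0 : 0 ≤ π₀) (h1 : π₀ ≤ 1)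
    (S : ScanStrategy) : S.IsCondLaw f₀ f₁ π₀ 0 := by
  intro G hG
  have := lintegral_types hf₀ hf₁ h0 h1 0 (B := fun p => G (0, p.2)) (by fun_prop)
    (fun _ _ _ _ _ => rfl)
  simpa only [hist_zero, curType, seqOne, seqTwo, pairIdx, belief, initialWeights_prior] using this

/-- `lintegral_next` is applied both to `G` and to the average of `G` over the updated weights.
Conditionally on the past, the two become the same integral against `mixDensity`, one by exchanging
the order of types and observation, the other because the average no longer depends on the types. -/
lemma IsCondLaw.succ (hf₀ : IsPdf f₀) (hf₁ : IsPdf f₁) (h0 : 0 ≤ π₀)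
    (h1 : π₀ ≤ 1) {S : ScanStrategy} {k : ℕ} (hk : S.IsCondLaw f₀ f₁ π₀ k) :
    S.IsCondLaw f₀ f₁ π₀ (k + 1) := by
  intro G hG
  obtain ⟨w, hwm, hw⟩ := S.exists_hist_comp (S.measurable_nextPrior (π₀ := π₀) hf₀ hf₁ k)
  have hupd : Measurable fun q : (ℕ → ℝ) × ℝ => Function.update q.1 (k + 1) q.2 :=
    measurable_update_pair (E := fun _ : ℕ => ℝ) (k + 1)
  have hψ : Measurable fun q : (ℕ → ℝ) × (Bool × Bool) × ℝ =>
      G (Function.update q.1 (k + 1) q.2.2, q.2.1) :=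
    hG.comp ((hupd.comp (measurable_fst.prodMk (measurable_snd.comp measurable_snd))).prodMk
      (measurable_fst.comp measurable_snd))
  have hψ' : Measurable fun q : (ℕ → ℝ) × (Bool × Bool) × ℝ =>
      ∑ b, ENNReal.ofReal (initialWeights (bayes f₀ f₁ (w q.1) q.2.2) b) *
        G (Function.update q.1 (k + 1) q.2.2, b) := by
    refine Finset.measurable_sum _ fun b _ => Measurable.mul ?_ ?_
    · exact ((measurable_initialWeights b).comp ((measurable_bayes hf₀ hf₁).comp
        ((hwm.comp measurable_fst).prodMk (measurable_snd.comp measurable_snd)))).ennreal_ofReal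
    · exact hG.comp ((hupd.comp (measurable_fst.prodMk
        (measurable_snd.comp measurable_snd))).prodMk measurable_const)
  have e1 := hk.lintegral_next hf₀ hf₁ h0 h1 hψ
  have e2 := hk.lintegral_next hf₀ hf₁ h0 h1 hψ'
  simp only [← hist_succ, ← hw, ← belief_succ] at e1 e2
  rw [e1, e2]
  refine lintegral_congr fun ω => ?_
  have hp := S.nextPrior_mem_simplex hf₀ hf₁ h0 h1 k ω
  rw [lintegral_mixDensity hf₀ hf₁ hp
    (fun b z => G (Function.update (hist S.φ k ω) (k + 1) z, b))
    fun b => hψ.comp (measurable_const.prodMk (measurable_const.prodMk measurable_id)),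
    lintegral_mixDensity_mul hf₀ hf₁ hp]
  simp only [hw]
  exact hψ'.comp (f := fun z => (hist S.φ k ω, (true, true), z)) (by fun_prop)

lemma isCondLaw (hf₀ : IsPdf f₀) (hf₁ : IsPdf f₁) (h0 : 0 ≤ π₀) (h1 : π₀ ≤ 1)
    (S : ScanStrategy) (k : ℕ) : S.IsCondLaw f₀ f₁ π₀ k := by
  induction k with
  | zero => exact S.isCondLaw_zero hf₀ hf₁ h0 h1
  | succ k ih => exact ih.succ hf₀ hf₁ h0 h1

/-- The conditional density of the next observation is `mixDensity`. -/
lemma lintegral_next_Z (hf₀ : IsPdf f₀) (hf₁ : IsPdf f₁) (h0 : 0 ≤ π₀) (h1 : π₀ ≤ 1)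
    (S : ScanStrategy) (k : ℕ) {ψ : (ℕ → ℝ) × ℝ → ℝ≥0∞} (hψ : Measurable ψ) :
    ∫⁻ ω, ψ (hist S.φ k ω, Z S.φ (k + 1) ω) ∂law f₀ f₁ π₀ =
      ∫⁻ ω, (∫⁻ z, ENNReal.ofReal (mixDensity f₀ f₁ (S.nextPrior f₀ f₁ π₀ k ω) z) *
        ψ (hist S.φ k ω, z)) ∂law f₀ f₁ π₀ := by
  have e := (S.isCondLaw hf₀ hf₁ h0 h1 k).lintegral_next hf₀ hf₁ h0 h1
    (ψ := fun q => ψ (q.1, q.2.2)) (by fun_prop)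
  refine e.trans (lintegral_congr fun ω => ?_)
  exact lintegral_mixDensity_mul hf₀ hf₁ (S.nextPrior_mem_simplex hf₀ hf₁ h0 h1 k ω)
    (hψ.comp measurable_prodMk_left)

lemma abs_initialWeights_le {p : ℝ × ℝ} (hp : p ∈ simplex) (b : Bool × Bool) :
    |initialWeights p b| ≤ 1 := by
  rw [abs_of_nonneg (initialWeights_nonneg hp b)]
  obtain ⟨h1, h2, h3⟩ := hp
  rcases b with ⟨_ | _, _ | _⟩ <;> simp only [initialWeights] <;> linarith

/-- The conditional probability of a set of types. -/
lemma condExp_curType (hf₀ : IsPdf f₀) (hf₁ : IsPdf f₁) (h0 : 0 ≤ π₀) (h1 : π₀ ≤ 1)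
    (S : ScanStrategy) (k : ℕ) (A : Finset (Bool × Bool)) :
    (law f₀ f₁ π₀)[(S.curType k ⁻¹' A).indicator (fun _ => (1 : ℝ)) | S.F k]
      =ᵐ[law f₀ f₁ π₀] fun ω => ∑ b ∈ A, initialWeights (S.belief f₀ f₁ π₀ k ω) b := by
  have := isProbabilityMeasure_law hf₀ hf₁ h0 h1
  have hA : MeasurableSet (S.curType k ⁻¹' A) := S.measurable_curType k A.measurableSet
  have hb := S.belief_mem_simplex hf₀ hf₁ h0 h1 k
  have hgm : Measurable[S.F k] fun ω => ∑ b ∈ A, initialWeights (S.belief f₀ f₁ π₀ k ω) b :=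
    Finset.measurable_sum _ fun b _ =>
      (measurable_initialWeights b).comp (S.measurable_belief hf₀ hf₁ k)
  have hnn (ω : Space) : 0 ≤ ∑ b ∈ A, initialWeights (S.belief f₀ f₁ π₀ k ω) b :=
    Finset.sum_nonneg fun b _ => initialWeights_nonneg (hb ω) b
  have hint : Integrable (fun ω => ∑ b ∈ A, initialWeights (S.belief f₀ f₁ π₀ k ω) b)
      (law f₀ f₁ π₀) := by
    refine integrable_finsetSum _ fun b _ => Integrable.of_bound (C := 1) ?_ ?_
    · exact ((measurable_initialWeights b).comp
        ((S.measurable_belief hf₀ hf₁ k).mono (S.F.le k) le_rfl)).aestronglyMeasurable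
    · exact Filter.Eventually.of_forall fun ω => abs_initialWeights_le (hb ω) b
  refine (ae_eq_condExp_of_forall_setIntegral_eq (S.F.le k)
    ((integrable_const (1 : ℝ)).indicator hA) (fun s _ _ => hint.integrableOn)
    (fun s hs _ => ?_) hgm.stronglyMeasurable.aestronglyMeasurable).symm
  rw [integral_eq_lintegral_of_nonneg_ae (Filter.Eventually.of_forall hnn)
      hint.aestronglyMeasurable.restrict,
    integral_eq_lintegral_of_nonneg_ae
      (Filter.Eventually.of_forall (Set.indicator_nonneg fun _ _ => zero_le_one))
      ((measurable_const.indicator hA).aestronglyMeasurable)]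
  congr 1
  have hs' : MeasurableSet s := S.F.le k s hs
  rw [S.F_eq_comap] at hs
  obtain ⟨E, hE, rfl⟩ := hs
  rw [← lintegral_indicator hs', ← lintegral_indicator hs']
  set G : (ℕ → ℝ) × (Bool × Bool) → ℝ≥0∞ := (E ×ˢ (A : Set (Bool × Bool))).indicator 1 with hG
  have hGm : Measurable G := measurable_one.indicator (hE.prod A.measurableSet)
  refine Eq.trans (lintegral_congr fun ω => ?_)
    ((S.isCondLaw hf₀ hf₁ h0 h1 k G hGm).symm.trans (lintegral_congr fun ω => ?_))
  · by_cases h : hist S.φ k ω ∈ E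
    · rw [Set.indicator_of_mem (show ω ∈ hist S.φ k ⁻¹' E from h),
        ENNReal.ofReal_sum_of_nonneg fun b _ => initialWeights_nonneg (hb ω) b,
        ← Finset.sum_filter_add_sum_filter_not Finset.univ (· ∈ A), Finset.filter_mem_eq_inter,
        Finset.univ_inter, Finset.sum_eq_zero (s := Finset.univ.filter (· ∉ A)), add_zero]
      · refine Finset.sum_congr rfl fun b hb => ?_
        simp [hG, h, hb]
      · intro b hb
        simp [hG, (Finset.mem_filter.1 hb).2]
    · rw [Set.indicator_of_notMem (show ω ∉ hist S.φ k ⁻¹' E from h)]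
      simp [hG, h]
  · by_cases h : hist S.φ k ω ∈ E <;> by_cases h' : S.curType k ω ∈ A <;>
      simp [hG, h, h', Set.indicator]

/-- The posteriors are conditional probabilities of sets of types; the two halves `p.2 / 2` for the
mixed types add up to the second coordinate. -/
lemma posterior_ae_eq (hf₀ : IsPdf f₀) (hf₁ : IsPdf f₁) (h0 : 0 ≤ π₀) (h1 : π₀ ≤ 1)
    (S : ScanStrategy) (k : ℕ) :
    S.posterior f₀ f₁ π₀ k =ᵐ[law f₀ f₁ π₀] S.belief f₀ f₁ π₀ k := by
  have e1 : S.bothEvent k = S.curType k ⁻¹' ({(true, true)} : Finset (Bool × Bool)) := by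
    ext ω
    simp [bothEvent, curType]
  have e2 : S.mixEvent k =
      S.curType k ⁻¹' ({(true, false), (false, true)} : Finset (Bool × Bool)) := by
    ext ω
    simp only [mixEvent, curType, Set.mem_ofPred_eq, Set.mem_preimage, Finset.coe_insert,
      Finset.coe_singleton, Set.mem_insert_iff, Set.mem_singleton_iff, Prod.mk.injEq]
    cases H (seqOne S.φ k ω) ω <;> cases H (seqTwo S.φ k ω) ω <;> simp
  filter_upwards [S.condExp_curType hf₀ hf₁ h0 h1 k {(true, true)},
    S.condExp_curType hf₀ hf₁ h0 h1 k {(true, false), (false, true)}] with ω ha hb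
  rw [← e1] at ha
  rw [← e2] at hb
  simp only [posterior, ha, hb]
  ext <;> simp [initialWeights]

lemma ae_posterior_eq (hf₀ : IsPdf f₀) (hf₁ : IsPdf f₁) (h0 : 0 ≤ π₀) (h1 : π₀ ≤ 1)
    (S : ScanStrategy) : ∀ᵐ ω ∂law f₀ f₁ π₀, ∀ k,
      S.posterior f₀ f₁ π₀ k ω = S.belief f₀ f₁ π₀ k ω :=
  ae_all_iff.2 fun k => S.posterior_ae_eq hf₀ hf₁ h0 h1 k

end ScanStrategy

/-! ### The expected next value -/

section NextValue

variable {f₀ f₁ : ℝ → ℝ} {π₀ : ℝ}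

lemma measurableSet_simplex : MeasurableSet simplex := by
  have h1 : MeasurableSet {p : ℝ × ℝ | 0 ≤ p.1} := measurableSet_le measurable_const measurable_fst
  have h2 : MeasurableSet {p : ℝ × ℝ | 0 ≤ p.2} := measurableSet_le measurable_const measurable_snd
  have h3 : MeasurableSet {p : ℝ × ℝ | p.1 + p.2 ≤ 1} :=
    measurableSet_le (measurable_fst.add measurable_snd) measurable_const
  exact h1.inter (h2.inter h3)

lemma measurable_integrand (hf₀ : IsPdf f₀) (hf₁ : IsPdf f₁) {V : ℝ × ℝ → ℝ} (hV : Measurable V) :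
    Measurable fun q : (ℝ × ℝ) × ℝ => V (bayes f₀ f₁ q.1 q.2) * mixDensity f₀ f₁ q.1 q.2 :=
  (hV.comp (measurable_bayes hf₀ hf₁)).mul (measurable_mixDensity hf₀ hf₁)

lemma measurable_Φc (hf₀ : IsPdf f₀) (hf₁ : IsPdf f₁) {V : ℝ × ℝ → ℝ} (hV : Measurable V) :
    Measurable (Φc f₀ f₁ V) :=
  (measurable_integrand hf₀ hf₁ hV).stronglyMeasurable.integral_prod_right.measurable

lemma Φs_eq (V : ℝ × ℝ → ℝ) : Φs f₀ f₁ π₀ V = Φc f₀ f₁ V (prior π₀) := rfl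

lemma integrable_mixDensity (hf₀ : IsPdf f₀) (hf₁ : IsPdf f₁) {p : ℝ × ℝ} (hp : p ∈ simplex) :
    Integrable (mixDensity f₀ f₁ p) := by
  refine ⟨((measurable_mixDensity hf₀ hf₁).comp measurable_prodMk_left).aestronglyMeasurable, ?_⟩
  rw [hasFiniteIntegral_iff_ofReal (Filter.Eventually.of_forall (mixDensity_nonneg hf₀ hf₁ hp)),
    lintegral_mixDensity_eq_one hf₀ hf₁ hp]
  exact ENNReal.one_lt_top

lemma integral_mixDensity (hf₀ : IsPdf f₀) (hf₁ : IsPdf f₁) {p : ℝ × ℝ} (hp : p ∈ simplex) :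
    ∫ z, mixDensity f₀ f₁ p z = 1 := by
  rw [integral_eq_lintegral_of_nonneg_ae
    (Filter.Eventually.of_forall (mixDensity_nonneg hf₀ hf₁ hp))
    (integrable_mixDensity hf₀ hf₁ hp).aestronglyMeasurable,
    lintegral_mixDensity_eq_one hf₀ hf₁ hp, ENNReal.toReal_one]

lemma norm_integrand_le (hf₀ : IsPdf f₀) (hf₁ : IsPdf f₁) {p : ℝ × ℝ} (hp : p ∈ simplex)
    {V : ℝ × ℝ → ℝ} {B : ℝ} (hB : ∀ q ∈ simplex, |V q| ≤ B) (z : ℝ) :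
    ‖V (bayes f₀ f₁ p z) * mixDensity f₀ f₁ p z‖ ≤ B * mixDensity f₀ f₁ p z := by
  rw [norm_mul, Real.norm_eq_abs, Real.norm_eq_abs,
    abs_of_nonneg (mixDensity_nonneg hf₀ hf₁ hp z)]
  exact mul_le_mul_of_nonneg_right (hB _ (bayes_mem_simplex hf₀ hf₁ hp z))
    (mixDensity_nonneg hf₀ hf₁ hp z)

lemma integrable_integrand (hf₀ : IsPdf f₀) (hf₁ : IsPdf f₁) {p : ℝ × ℝ} (hp : p ∈ simplex)
    {V : ℝ × ℝ → ℝ} (hV : Measurable V) {B : ℝ} (hB : ∀ q ∈ simplex, |V q| ≤ B) :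
    Integrable fun z => V (bayes f₀ f₁ p z) * mixDensity f₀ f₁ p z :=
  ((integrable_mixDensity hf₀ hf₁ hp).const_mul B).mono'
    ((measurable_integrand hf₀ hf₁ hV).comp measurable_prodMk_left).aestronglyMeasurable
    (Filter.Eventually.of_forall (norm_integrand_le hf₀ hf₁ hp hB))

lemma abs_Φc_le (hf₀ : IsPdf f₀) (hf₁ : IsPdf f₁) {p : ℝ × ℝ} (hp : p ∈ simplex)
    {V : ℝ × ℝ → ℝ} {B : ℝ} (hB : ∀ q ∈ simplex, |V q| ≤ B) :
    |Φc f₀ f₁ V p| ≤ B := by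
  have := norm_integral_le_of_norm_le ((integrable_mixDensity hf₀ hf₁ hp).const_mul B)
    (Filter.Eventually.of_forall (norm_integrand_le hf₀ hf₁ hp hB))
  rwa [integral_const_mul, integral_mixDensity hf₀ hf₁ hp, mul_one] at this

/-- A Bayes update never leaves the simplex. Hence a solution may be replaced by its extension by
zero, which is measurable on the whole plane. -/
lemma Φc_congr (hf₀ : IsPdf f₀) (hf₁ : IsPdf f₁) {p : ℝ × ℝ} (hp : p ∈ simplex)
    {V W : ℝ × ℝ → ℝ} (h : ∀ q ∈ simplex, V q = W q) : Φc f₀ f₁ V p = Φc f₀ f₁ W p := by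
  unfold Φc
  simp only [fun z => h _ (bayes_mem_simplex hf₀ hf₁ hp z)]

lemma Φc_mono (hf₀ : IsPdf f₀) (hf₁ : IsPdf f₁) {p : ℝ × ℝ} (hp : p ∈ simplex)
    {V W : ℝ × ℝ → ℝ} (hV : Measurable V) (hW : Measurable W) {B : ℝ}
    (hVB : ∀ q ∈ simplex, |V q| ≤ B) (hWB : ∀ q ∈ simplex, |W q| ≤ B)
    (h : ∀ q ∈ simplex, V q ≤ W q) : Φc f₀ f₁ V p ≤ Φc f₀ f₁ W p :=
  integral_mono (integrable_integrand hf₀ hf₁ hp hV hVB) (integrable_integrand hf₀ hf₁ hp hW hWB)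
    fun z => mul_le_mul_of_nonneg_right (h _ (bayes_mem_simplex hf₀ hf₁ hp z))
      (mixDensity_nonneg hf₀ hf₁ hp z)

lemma Φc_add_const (hf₀ : IsPdf f₀) (hf₁ : IsPdf f₁) {p : ℝ × ℝ} (hp : p ∈ simplex)
    {V : ℝ × ℝ → ℝ} (hV : Measurable V) {B : ℝ} (hVB : ∀ q ∈ simplex, |V q| ≤ B) (a : ℝ) :
    Φc f₀ f₁ (fun q => V q + a) p = Φc f₀ f₁ V p + a := by
  simp only [Φc, add_mul]
  rw [integral_add (integrable_integrand hf₀ hf₁ hp hV hVB)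
    ((integrable_mixDensity hf₀ hf₁ hp).const_mul a), integral_const_mul,
    integral_mixDensity hf₀ hf₁ hp, mul_one]

lemma ofReal_Φc (hf₀ : IsPdf f₀) (hf₁ : IsPdf f₁) {p : ℝ × ℝ} (hp : p ∈ simplex)
    {V : ℝ × ℝ → ℝ} (hV : Measurable V) {B : ℝ} (hVB : ∀ q ∈ simplex, |V q| ≤ B)
    (h0 : ∀ q ∈ simplex, 0 ≤ V q) :
    ENNReal.ofReal (Φc f₀ f₁ V p) =
      ∫⁻ z, ENNReal.ofReal (mixDensity f₀ f₁ p z) * ENNReal.ofReal (V (bayes f₀ f₁ p z)) := by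
  rw [Φc, ofReal_integral_eq_lintegral_ofReal (integrable_integrand hf₀ hf₁ hp hV hVB)
    (Filter.Eventually.of_forall fun z => mul_nonneg (h0 _ (bayes_mem_simplex hf₀ hf₁ hp z))
      (mixDensity_nonneg hf₀ hf₁ hp z))]
  refine lintegral_congr fun z => ?_
  rw [mul_comm, ENNReal.ofReal_mul (mixDensity_nonneg hf₀ hf₁ hp z)]

/-! ### The transition operator as a conditional expectation -/

namespace ScanStrategy

lemma integrable_comp_belief (hf₀ : IsPdf f₀) (hf₁ : IsPdf f₁) (h0 : 0 ≤ π₀) (h1 : π₀ ≤ 1)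
    (S : ScanStrategy) (k : ℕ) {V : ℝ × ℝ → ℝ} (hV : Measurable V) {B : ℝ}
    (hB : ∀ q ∈ simplex, |V q| ≤ B) :
    Integrable (fun ω => V (S.belief f₀ f₁ π₀ k ω)) (law f₀ f₁ π₀) := by
  have := isProbabilityMeasure_law hf₀ hf₁ h0 h1
  refine Integrable.of_bound (C := B) (hV.comp ((S.measurable_belief hf₀ hf₁ k).mono (S.F.le k)
    le_rfl)).aestronglyMeasurable (Filter.Eventually.of_forall fun ω => ?_)
  exact hB _ (S.belief_mem_simplex hf₀ hf₁ h0 h1 k ω)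

lemma integrable_Φc_nextPrior (hf₀ : IsPdf f₀) (hf₁ : IsPdf f₁) (h0 : 0 ≤ π₀) (h1 : π₀ ≤ 1)
    (S : ScanStrategy) (k : ℕ) {V : ℝ × ℝ → ℝ} (hV : Measurable V) {B : ℝ}
    (hB : ∀ q ∈ simplex, |V q| ≤ B) :
    Integrable (fun ω => Φc f₀ f₁ V (S.nextPrior f₀ f₁ π₀ k ω)) (law f₀ f₁ π₀) := by
  have := isProbabilityMeasure_law hf₀ hf₁ h0 h1
  refine Integrable.of_bound (C := B) ((measurable_Φc hf₀ hf₁ hV).comp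
    ((S.measurable_nextPrior hf₀ hf₁ k).mono (S.F.le k) le_rfl)).aestronglyMeasurable
    (Filter.Eventually.of_forall fun ω => ?_)
  exact abs_Φc_le hf₀ hf₁ (S.nextPrior_mem_simplex hf₀ hf₁ h0 h1 k ω) hB

lemma condExp_belief_of_nonneg (hf₀ : IsPdf f₀) (hf₁ : IsPdf f₁) (h0 : 0 ≤ π₀) (h1 : π₀ ≤ 1)
    (S : ScanStrategy) (k : ℕ) {V : ℝ × ℝ → ℝ} (hV : Measurable V) {B : ℝ}
    (hB : ∀ q ∈ simplex, |V q| ≤ B) (hV0 : ∀ q ∈ simplex, 0 ≤ V q) :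
    (law f₀ f₁ π₀)[fun ω => V (S.belief f₀ f₁ π₀ (k + 1) ω) | S.F k] =ᵐ[law f₀ f₁ π₀]
      fun ω => Φc f₀ f₁ V (S.nextPrior f₀ f₁ π₀ k ω) := by
  have := isProbabilityMeasure_law hf₀ hf₁ h0 h1
  have hp := S.nextPrior_mem_simplex hf₀ hf₁ h0 h1 k
  have hm := (measurable_Φc hf₀ hf₁ hV).comp (S.measurable_nextPrior (π₀ := π₀) hf₀ hf₁ k)
  have hi := S.integrable_Φc_nextPrior hf₀ hf₁ h0 h1 k hV hB
  have hi' := S.integrable_comp_belief hf₀ hf₁ h0 h1 (k + 1) hV hB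
  refine (ae_eq_condExp_of_forall_setIntegral_eq (S.F.le k) hi' (fun s _ _ => hi.integrableOn)
    (fun s hs _ => ?_) hm.stronglyMeasurable.aestronglyMeasurable).symm
  have hΦ0 (ω : Space) : 0 ≤ Φc f₀ f₁ V (S.nextPrior f₀ f₁ π₀ k ω) :=
    integral_nonneg fun z => mul_nonneg (hV0 _ (bayes_mem_simplex hf₀ hf₁ (hp ω) z))
      (mixDensity_nonneg hf₀ hf₁ (hp ω) z)
  rw [integral_eq_lintegral_of_nonneg_ae (Filter.Eventually.of_forall hΦ0)
      hi.aestronglyMeasurable.restrict,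
    integral_eq_lintegral_of_nonneg_ae (Filter.Eventually.of_forall fun ω =>
      hV0 _ (S.belief_mem_simplex hf₀ hf₁ h0 h1 (k + 1) ω)) hi'.aestronglyMeasurable.restrict]
  congr 1
  have hs' : MeasurableSet s := S.F.le k s hs
  rw [S.F_eq_comap] at hs
  obtain ⟨E, hE, rfl⟩ := hs
  rw [← lintegral_indicator hs', ← lintegral_indicator hs']
  obtain ⟨w, hwm, hw⟩ := S.exists_hist_comp (S.measurable_nextPrior (π₀ := π₀) hf₀ hf₁ k)
  have hψ : Measurable fun q : (ℕ → ℝ) × ℝ => E.indicator (fun _ => (1 : ℝ≥0∞)) q.1 *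
      ENNReal.ofReal (V (bayes f₀ f₁ (w q.1) q.2)) := by
    refine ((measurable_const.indicator hE).comp measurable_fst).mul ?_
    exact (hV.comp ((measurable_bayes hf₀ hf₁).comp
      ((hwm.comp measurable_fst).prodMk measurable_snd))).ennreal_ofReal
  have key := S.lintegral_next_Z hf₀ hf₁ h0 h1 k hψ
  refine Eq.trans (lintegral_congr fun ω => ?_) (key.symm.trans (lintegral_congr fun ω => ?_))
  · by_cases h : hist S.φ k ω ∈ E
    · rw [Set.indicator_of_mem (show ω ∈ hist S.φ k ⁻¹' E from h)]
      simp only [Set.indicator_of_mem h, one_mul, ← hw]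
      exact ofReal_Φc hf₀ hf₁ (hp ω) hV hB hV0
    · rw [Set.indicator_of_notMem (show ω ∉ hist S.φ k ⁻¹' E from h)]
      simp [h]
  · by_cases h : hist S.φ k ω ∈ E
    · rw [Set.indicator_of_mem (show ω ∈ hist S.φ k ⁻¹' E from h)]
      simp only [Set.indicator_of_mem h, one_mul, ← hw, belief_succ]
    · rw [Set.indicator_of_notMem (show ω ∉ hist S.φ k ⁻¹' E from h)]
      simp [h]

/-- The transition formula is available for nonnegative integrands, so `V` is shifted by its bound;
the shift cancels because `mixDensity` has total mass one. -/
lemma condExp_belief (hf₀ : IsPdf f₀) (hf₁ : IsPdf f₁) (h0 : 0 ≤ π₀) (h1 : π₀ ≤ 1)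
    (S : ScanStrategy) (k : ℕ) {V : ℝ × ℝ → ℝ} (hV : Measurable V) {B : ℝ}
    (hB : ∀ q ∈ simplex, |V q| ≤ B) :
    (law f₀ f₁ π₀)[fun ω => V (S.belief f₀ f₁ π₀ (k + 1) ω) | S.F k] =ᵐ[law f₀ f₁ π₀]
      fun ω => Φc f₀ f₁ V (S.nextPrior f₀ f₁ π₀ k ω) := by
  have := isProbabilityMeasure_law hf₀ hf₁ h0 h1
  have hB' : ∀ q ∈ simplex, |V q + B| ≤ B + B := fun q hq => by
    have := abs_le.1 (hB q hq)
    rw [abs_of_nonneg (by linarith)]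
    linarith
  have hn := S.condExp_belief_of_nonneg hf₀ hf₁ h0 h1 k (hV.add_const B) hB'
    fun q hq => by linarith [(abs_le.1 (hB q hq)).1]
  have ha := condExp_add (S.integrable_comp_belief hf₀ hf₁ h0 h1 (k + 1) hV hB)
    (integrable_const B) (S.F k)
  filter_upwards [hn, ha] with ω h2 h3
  rw [Φc_add_const hf₀ hf₁ (S.nextPrior_mem_simplex hf₀ hf₁ h0 h1 k ω) hV hB] at h2
  have e : ((fun ω => V (S.belief f₀ f₁ π₀ (k + 1) ω)) + fun _ => B) =
    fun ω => V (S.belief f₀ f₁ π₀ (k + 1) ω) + B := rfl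
  rw [e, Pi.add_apply, condExp_const (S.F.le k)] at h3
  linarith

end ScanStrategy

/-- A bounded measurable function on the simplex, extended by zero. -/
lemma measurable_indicator_simplex {U : ℝ × ℝ → ℝ} (hU : Measurable fun p : simplex => U p) :
    Measurable (simplex.indicator U) := by
  refine measurable_of_restrict_of_restrict_compl measurableSet_simplex ?_ ?_
  · convert hU using 1
    ext p
    simp [Set.domRestrict_apply]
  · have : simplexᶜ.domRestrict (simplex.indicator U) = fun _ => 0 := by
      ext p
      simp [Set.domRestrict_apply, Set.indicator_of_notMem p.2]
    rw [this]
    exact measurable_const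

/-- The optimality equation plays no role here: continuing and switching differ only in the point at
which `Φc` is evaluated, the current belief or the prior. -/
lemma isNextValue_of_measurable (hf₀ : IsPdf f₀) (hf₁ : IsPdf f₁) (h0 : 0 ≤ π₀) (h1 : π₀ ≤ 1)
    {U : ℝ × ℝ → ℝ} (hU : Measurable fun p : simplex => U p) {B : ℝ}
    (hB : ∀ p ∈ simplex, |U p| ≤ B) : IsNextValue f₀ f₁ π₀ U := by
  intro S k
  have e : ∀ q ∈ simplex, simplex.indicator U q = U q := fun q hq => Set.indicator_of_mem hq U
  have hb := S.belief_mem_simplex (f₀ := f₀) (f₁ := f₁) (π₀ := π₀) hf₀ hf₁ h0 h1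
  have hc : (fun ω => U (S.posterior f₀ f₁ π₀ (k + 1) ω)) =ᵐ[law f₀ f₁ π₀]
      fun ω => simplex.indicator U (S.belief f₀ f₁ π₀ (k + 1) ω) := by
    filter_upwards [S.posterior_ae_eq hf₀ hf₁ h0 h1 (k + 1)] with ω hω
    rw [hω, e _ (hb _ ω)]
  filter_upwards [condExp_congr_ae (m := S.F k) hc, S.posterior_ae_eq hf₀ hf₁ h0 h1 k,
    S.condExp_belief hf₀ hf₁ h0 h1 k (measurable_indicator_simplex hU) (B := B)
      fun q hq => by rw [e q hq]; exact hB q hq] with ω h2 h3 h4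
  rw [h2, h4, h3, Φc_congr hf₀ hf₁ (S.nextPrior_mem_simplex hf₀ hf₁ h0 h1 k ω) e,
    ScanStrategy.nextPrior, Φs_eq]
  cases S.φ k ω <;> simp

end NextValue

/-! ### Existence of a solution -/

section Existence

/-- A measurable function on the simplex with values in the unit interval. -/
structure IsUnitCost (w : ℝ × ℝ → ℝ) : Prop where
  measurable : Measurable fun p : simplex => w p
  nonneg : ∀ p ∈ simplex, 0 ≤ w p
  le_one : ∀ p ∈ simplex, w p ≤ 1

variable {f₀ f₁ : ℝ → ℝ} {π₀ c : ℝ} {w : ℝ × ℝ → ℝ}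

/-- The value iteration for the optimality equation, started at zero. -/
def valueIter (f₀ f₁ : ℝ → ℝ) (π₀ c : ℝ) (w : ℝ × ℝ → ℝ) : ℕ → ℝ × ℝ → ℝ
  | 0 => fun _ => 0
  | n + 1 => simplex.indicator fun p => min (w p)
      (c + min (Φc f₀ f₁ (valueIter f₀ f₁ π₀ c w n) p)
        (Φs f₀ f₁ π₀ (valueIter f₀ f₁ π₀ c w n)))

lemma valueIter_succ {p : ℝ × ℝ} (hp : p ∈ simplex) (n : ℕ) :
    valueIter f₀ f₁ π₀ c w (n + 1) p = min (w p)
      (c + min (Φc f₀ f₁ (valueIter f₀ f₁ π₀ c w n) p)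
        (Φs f₀ f₁ π₀ (valueIter f₀ f₁ π₀ c w n))) :=
  Set.indicator_of_mem hp _

lemma measurable_valueIter (hf₀ : IsPdf f₀) (hf₁ : IsPdf f₁) (hw : IsUnitCost w) (n : ℕ) :
    Measurable (valueIter f₀ f₁ π₀ c w n) := by
  induction n with
  | zero => exact measurable_const
  | succ n ih =>
    refine measurable_indicator_simplex
      (hw.measurable.min (measurable_const.add (Measurable.min ?_ measurable_const)))
    exact (measurable_Φc hf₀ hf₁ ih).comp measurable_subtype_coe

lemma valueIter_bounds (hf₀ : IsPdf f₀) (hf₁ : IsPdf f₁) (h0 : 0 ≤ π₀) (h1 : π₀ ≤ 1) (hc : 0 < c)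
    (hw : IsUnitCost w) (n : ℕ) :
    ∀ p, 0 ≤ valueIter f₀ f₁ π₀ c w n p ∧ valueIter f₀ f₁ π₀ c w n p ≤ 1 := by
  induction n with
  | zero => exact fun p => ⟨le_rfl, zero_le_one⟩
  | succ n ih =>
    intro p
    by_cases hp : p ∈ simplex
    · have hΦ (q : ℝ × ℝ) (hq : q ∈ simplex) :
          0 ≤ Φc f₀ f₁ (valueIter f₀ f₁ π₀ c w n) q :=
        integral_nonneg fun z => mul_nonneg (ih _).1 (mixDensity_nonneg hf₀ hf₁ hq z)
      rw [valueIter_succ hp]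
      exact ⟨le_min (hw.nonneg p hp)
        (add_nonneg hc.le (le_min (hΦ p hp) (hΦ _ (prior_mem_simplex h0 h1)))),
        (min_le_left _ _).trans (hw.le_one p hp)⟩
    · simp [valueIter, hp]

lemma abs_valueIter_le (hf₀ : IsPdf f₀) (hf₁ : IsPdf f₁) (h0 : 0 ≤ π₀) (h1 : π₀ ≤ 1) (hc : 0 < c)
    (hw : IsUnitCost w) (n : ℕ) (p : ℝ × ℝ) : |valueIter f₀ f₁ π₀ c w n p| ≤ 1 := by
  obtain ⟨h2, h3⟩ := valueIter_bounds hf₀ hf₁ h0 h1 hc hw n p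
  rwa [abs_of_nonneg h2]

/-- The start at zero gives the first inequality, and monotonicity of the operator propagates it.
There is no discounting that would make the iteration an evident contraction, so monotone limits are
used instead. -/
lemma valueIter_le_succ (hf₀ : IsPdf f₀) (hf₁ : IsPdf f₁) (h0 : 0 ≤ π₀) (h1 : π₀ ≤ 1) (hc : 0 < c)
    (hw : IsUnitCost w) (n : ℕ) :
    ∀ p, valueIter f₀ f₁ π₀ c w n p ≤ valueIter f₀ f₁ π₀ c w (n + 1) p := by
  induction n with
  | zero => exact fun p => (valueIter_bounds hf₀ hf₁ h0 h1 hc hw 1 p).1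
  | succ n ih =>
    intro p
    by_cases hp : p ∈ simplex
    · have hΦ (q : ℝ × ℝ) (hq : q ∈ simplex) : Φc f₀ f₁ (valueIter f₀ f₁ π₀ c w n) q ≤
          Φc f₀ f₁ (valueIter f₀ f₁ π₀ c w (n + 1)) q :=
        Φc_mono hf₀ hf₁ hq (measurable_valueIter hf₀ hf₁ hw n)
          (measurable_valueIter hf₀ hf₁ hw (n + 1))
          (fun q _ => abs_valueIter_le hf₀ hf₁ h0 h1 hc hw n q)
          (fun q _ => abs_valueIter_le hf₀ hf₁ h0 h1 hc hw (n + 1) q) fun q _ => ih q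
      rw [valueIter_succ hp, valueIter_succ hp]
      exact min_le_min_left _ (add_le_add_right
        (min_le_min (hΦ p hp) (hΦ _ (prior_mem_simplex h0 h1))) c)
    · simp [valueIter, hp]

/-- The optimality equation with a measurable stopping cost `w` between `0` and `1` has a bounded
measurable solution. -/
lemma exists_solution (hf₀ : IsPdf f₀) (hf₁ : IsPdf f₁) (h0 : 0 ≤ π₀) (h1 : π₀ ≤ 1) (hc : 0 < c)
    (hw : IsUnitCost w) : ∃ U : ℝ × ℝ → ℝ, Measurable U ∧ (∀ p, |U p| ≤ 1) ∧
      ∀ p ∈ simplex, U p = min (w p) (c + min (Φc f₀ f₁ U p) (Φs f₀ f₁ π₀ U)) := by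
  set u := valueIter f₀ f₁ π₀ c w with hu
  have hm := measurable_valueIter (π₀ := π₀) (c := c) hf₀ hf₁ hw
  have hlim (p : ℝ × ℝ) : Filter.Tendsto (fun n => u n p) Filter.atTop (nhds (⨆ n, u n p)) :=
    tendsto_atTop_ciSup
      (monotone_nat_of_le_succ fun n => valueIter_le_succ hf₀ hf₁ h0 h1 hc hw n p)
      ⟨1, by rintro _ ⟨n, rfl⟩; exact (valueIter_bounds hf₀ hf₁ h0 h1 hc hw n p).2⟩
  have hΦ (p : ℝ × ℝ) (hp : p ∈ simplex) : Filter.Tendsto (fun n => Φc f₀ f₁ (u n) p) Filter.atTop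
      (nhds (Φc f₀ f₁ (fun q => ⨆ n, u n q) p)) := by
    refine tendsto_integral_of_dominated_convergence (fun z => 1 * mixDensity f₀ f₁ p z)
      (fun n => ((measurable_integrand hf₀ hf₁ (hm n)).comp
        measurable_prodMk_left).aestronglyMeasurable)
      ((integrable_mixDensity hf₀ hf₁ hp).const_mul 1)
      (fun n => Filter.Eventually.of_forall (norm_integrand_le hf₀ hf₁ hp
        fun q _ => abs_valueIter_le hf₀ hf₁ h0 h1 hc hw n q))
      (Filter.Eventually.of_forall fun z => (hlim _).mul_const _)
  refine ⟨fun p => ⨆ n, u n p, measurable_of_tendsto_metrizable hm (tendsto_pi_nhds.2 hlim),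
    fun p => ?_, fun p hp => ?_⟩
  · exact le_of_tendsto (hlim p).abs (Filter.Eventually.of_forall fun n =>
      abs_valueIter_le hf₀ hf₁ h0 h1 hc hw n p)
  -- Both sides of the recursion converge, the right one by dominated convergence inside `Φc` and
  -- continuity of `min`; the limit therefore solves the equation.
  · refine tendsto_nhds_unique ((Filter.tendsto_add_atTop_iff_nat 1).2 (hlim p)) ?_
    simp only [hu, valueIter_succ hp]
    exact tendsto_const_nhds.min (tendsto_const_nhds.add
      ((hΦ p hp).min (hΦ _ (prior_mem_simplex h0 h1))))

end Existence

/-! ### Stopping times with values in the extended natural numbers -/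

section Stopping

variable {α : Type*} {mα : MeasurableSpace α}

lemma measurable_of_isStoppingTime {F : Filtration ℕ mα} {τ : α → ℕ∞} (hτ : IsStoppingTime F τ) :
    Measurable τ := by
  have hn (n : ℕ) : MeasurableSet (τ ⁻¹' {(n : ℕ∞)}) :=
    F.le n _ (hτ.measurableSet_eq_of_countable n)
  refine measurable_to_countable' fun x => ?_
  induction x with
  | top =>
    have : τ ⁻¹' {⊤} = (⋃ n : ℕ, τ ⁻¹' {(n : ℕ∞)})ᶜ := by
      ext ω
      simp only [Set.mem_preimage, Set.mem_singleton_iff, Set.mem_compl_iff, Set.mem_iUnion,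
        not_exists]
      induction τ ω with
      | top => simp
      | coe n => simp
    rw [this]
    exact (MeasurableSet.iUnion hn).compl
  | coe n => exact hn n

/-- At `⊤` `stoppedValue` evaluates at an arbitrary time, so only finite values of `τ` are
meaningful. -/
lemma stoppedValue_of_eq {β : Type*} [Nonempty β] {u : ℕ → α → β} {τ : α → ℕ∞} {ω : α} {n : ℕ}
    (h : τ ω = n) : stoppedValue u τ ω = u n ω := by
  have : (τ ω : WithTop ℕ) = ((n : ℕ) : WithTop ℕ) := h
  change u (WithTop.untopA (τ ω)) ω = u n ω
  rw [this]
  rfl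

lemma isStoppingTime_iInf_mem {F : Filtration ℕ mα} {β : Type*} [MeasurableSpace β]
    {u : ℕ → α → β} (hu : ∀ k, Measurable[F k] (u k)) {A : Set β} (hA : MeasurableSet A) :
    IsStoppingTime F fun ω => (⨅ (k : ℕ) (_ : u k ω ∈ A), (k : ℕ∞) : ℕ∞) := by
  intro i
  have : {ω | (⨅ (k : ℕ) (_ : u k ω ∈ A), (k : ℕ∞) : ℕ∞) ≤ (i : ℕ∞)} =
      ⋃ k ∈ Set.Iic i, u k ⁻¹' A := by
    ext ω
    simp only [Set.mem_ofPred_eq, Set.mem_iUnion, Set.mem_Iic, Set.mem_preimage, exists_prop]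
    constructor
    · intro h
      by_contra! hcon
      have : ((i + 1 : ℕ) : ℕ∞) ≤ ⨅ (k : ℕ) (_ : u k ω ∈ A), (k : ℕ∞) :=
        le_iInf₂ fun k hk => by
          by_contra! hlt
          exact hcon k (by have := Nat.cast_lt.1 hlt; omega) hk
      have := Nat.cast_le.1 (this.trans h)
      omega
    · rintro ⟨k, hk, hkA⟩
      exact (iInf₂_le k hkA).trans (Nat.cast_le.2 hk)
  have hm : MeasurableSet[F i] (⋃ k ∈ Set.Iic i, u k ⁻¹' A) :=
    MeasurableSet.biUnion (Set.to_countable _) fun k hk => F.mono hk _ (hu k hA)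
  rw [← this] at hm
  exact hm

/-- A finite infimum of natural numbers is attained: otherwise every admissible `k` would be at
least `n + 1`. -/
lemma iInf_mem_of_eq {β : Type*} {u : ℕ → β} {A : Set β} {n : ℕ}
    (h : (⨅ (k : ℕ) (_ : u k ∈ A), (k : ℕ∞)) = n) : u n ∈ A := by
  by_contra hn
  have : ((n + 1 : ℕ) : ℕ∞) ≤ ⨅ (k : ℕ) (_ : u k ∈ A), (k : ℕ∞) :=
    le_iInf₂ fun k hk => by
      have h1 : (n : ℕ∞) ≤ k := h ▸ iInf₂_le k hk
      have h2 : n ≤ k := Nat.cast_le.1 h1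
      have h3 : k ≠ n := fun e => hn (e ▸ hk)
      exact Nat.cast_le.2 (by omega)
  rw [h] at this
  have := Nat.cast_le.1 this
  omega

lemma notMem_of_lt_iInf {β : Type*} {u : ℕ → β} {A : Set β} {n : ℕ}
    (h : (n : ℕ∞) < ⨅ (k : ℕ) (_ : u k ∈ A), (k : ℕ∞)) : u n ∉ A :=
  fun hn => (iInf₂_le (f := fun k (_ : u k ∈ A) => (k : ℕ∞)) n hn).not_gt h

/-- Telescoping along a stopped sequence. -/
lemma sum_ite_lt_eq (c : ℝ) (u : ℕ → ℝ) (t : ℕ∞) (n : ℕ) :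
    ∑ i ∈ Finset.range n, (if (i : ℕ∞) < t then c + u (i + 1) - u i else 0) =
      c * (min t n).toNat + u (min t n).toNat - u 0 := by
  induction n with
  | zero => simp
  | succ n ih =>
    rw [Finset.sum_range_succ, ih]
    by_cases h : (n : ℕ∞) < t
    · have h2 : ((n + 1 : ℕ) : ℕ∞) ≤ t := by
        rw [Nat.cast_add, Nat.cast_one]
        exact Order.add_one_le_of_lt h
      rw [if_pos h, min_eq_right h.le, min_eq_right h2]
      rw [ENat.toNat_natCast, ENat.toNat_natCast]
      push_cast
      ring
    · have h' : t ≤ n := not_lt.1 h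
      rw [if_neg h, min_eq_left h', min_eq_left (h'.trans (Nat.cast_le.2 n.le_succ)), add_zero]

end Stopping

/-! ### A strategy that follows a rule -/

section Rule

variable {f₀ f₁ : ℝ → ℝ} {π₀ : ℝ}

/-- The number of the current pair and its posterior probabilities when the switching decisions
are made by a rule that looks at the posterior probabilities. -/
def ruleState (f₀ f₁ : ℝ → ℝ) (π₀ : ℝ) (r : ℝ × ℝ → Bool) : ℕ → Space → ℕ × (ℝ × ℝ)
  | 0, _ => (0, prior π₀)
  | k + 1, ω =>
    let s := ruleState f₀ f₁ π₀ r k ω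
    let i := s.1 + (r s.2).toNat
    (i, bayes f₀ f₁ (if r s.2 = true then prior π₀ else s.2)
      (Y (2 * i) (k + 1) ω + Y (2 * i + 1) (k + 1) ω))

/-- The switching decisions made by a rule. -/
def ruleSwitch (f₀ f₁ : ℝ → ℝ) (π₀ : ℝ) (r : ℝ × ℝ → Bool) (k : ℕ) (ω : Space) : Bool :=
  r (ruleState f₀ f₁ π₀ r k ω).2

lemma pairIdx_ruleSwitch (r : ℝ × ℝ → Bool) (k : ℕ) (ω : Space) :
    pairIdx (ruleSwitch f₀ f₁ π₀ r) k ω = (ruleState f₀ f₁ π₀ r k ω).1 := by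
  induction k with
  | zero => rfl
  | succ k ih => rw [pairIdx, ih]; rfl

/-- Decisions depend on posteriors, posteriors on observations, and observations on decisions.
`ruleState` breaks this circle by a recursion on the raw samples, and here it is recognized as the
Bayes recursion driven by its own mixed observations. -/
lemma ruleState_succ_snd (r : ℝ × ℝ → Bool) (k : ℕ) (ω : Space) :
    (ruleState f₀ f₁ π₀ r (k + 1) ω).2 =
      bayes f₀ f₁ (if ruleSwitch f₀ f₁ π₀ r k ω = true then prior π₀
        else (ruleState f₀ f₁ π₀ r k ω).2) (Z (ruleSwitch f₀ f₁ π₀ r) (k + 1) ω) := by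
  simp only [Z, seqOne, seqTwo, pairIdx_ruleSwitch]
  rfl

lemma measurable_ruleState (hf₀ : IsPdf f₀) (hf₁ : IsPdf f₁) {r : ℝ × ℝ → Bool}
    (hr : Measurable r) (k : ℕ) : Measurable (ruleState f₀ f₁ π₀ r k) := by
  induction k with
  | zero => exact measurable_const
  | succ k ih =>
    have hs2 := measurable_snd.comp ih
    have hi : Measurable fun ω => (ruleState f₀ f₁ π₀ r k ω).1 +
        (r (ruleState f₀ f₁ π₀ r k ω).2).toNat :=
      (measurable_fst.comp ih).add ((measurable_of_countable Bool.toNat).comp (hr.comp hs2))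
    have h : ∀ g : ℕ → ℕ, Measurable fun ω => Y (g ((ruleState f₀ f₁ π₀ r k ω).1 +
        (r (ruleState f₀ f₁ π₀ r k ω).2).toNat)) (k + 1) ω := fun g =>
      (measurable_from_prod_countable_right (f := fun x : ℕ × Space => Y (g x.1) (k + 1) x.2)
        fun n => measurable_Y (g n) (k + 1)).comp (hi.prodMk measurable_id)
    have hw : Measurable fun ω => if r (ruleState f₀ f₁ π₀ r k ω).2 = true then prior π₀
        else (ruleState f₀ f₁ π₀ r k ω).2 :=
      Measurable.ite ((hr.comp hs2) (measurableSet_singleton true)) measurable_const hs2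
    exact hi.prodMk ((measurable_bayes hf₀ hf₁).comp
      (hw.prodMk ((h fun n => 2 * n).add (h fun n => 2 * n + 1))))

lemma measurable_ruleSwitch (hf₀ : IsPdf f₀) (hf₁ : IsPdf f₁) {r : ℝ × ℝ → Bool}
    (hr : Measurable r) (k : ℕ) : Measurable (ruleSwitch f₀ f₁ π₀ r k) :=
  hr.comp (measurable_snd.comp (measurable_ruleState hf₀ hf₁ hr k))

lemma measurable_Z_scanFiltration {φ : ℕ → Space → Bool} (hφ : ∀ k, Measurable (φ k)) (k : ℕ) :
    Measurable[scanFiltration φ hφ k] (Z φ k) := by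
  have e : scanFiltration φ hφ k = ⨆ j ≤ k, MeasurableSpace.comap (Z φ j) inferInstance := rfl
  rw [e]
  exact Measurable.mono (comap_measurable _) (le_iSup₂_of_le k le_rfl le_rfl) le_rfl

lemma measurable_ruleState_scanFiltration (hf₀ : IsPdf f₀) (hf₁ : IsPdf f₁) {r : ℝ × ℝ → Bool}
    (hr : Measurable r) (k : ℕ) :
    Measurable[scanFiltration (ruleSwitch f₀ f₁ π₀ r) (measurable_ruleSwitch hf₀ hf₁ hr) k]
      fun ω => (ruleState f₀ f₁ π₀ r k ω).2 := by
  set F := scanFiltration (ruleSwitch f₀ f₁ π₀ r) (measurable_ruleSwitch hf₀ hf₁ hr) with hF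
  induction k with
  | zero => exact measurable_const
  | succ k ih =>
    have ih' := ih.mono (F.mono (Nat.le_succ k)) le_rfl
    have hw : Measurable[F (k + 1)] fun ω => if ruleSwitch f₀ f₁ π₀ r k ω = true then prior π₀
        else (ruleState f₀ f₁ π₀ r k ω).2 :=
      Measurable.ite ((hr.comp ih') (measurableSet_singleton true)) measurable_const ih'
    simp only [ruleState_succ_snd]
    exact (measurable_bayes hf₀ hf₁).comp (hw.prodMk (measurable_Z_scanFiltration _ (k + 1)))

/-- There is a strategy that switches by the rule `r` and stops when the posterior probabilities
enter the set `A`. -/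
lemma exists_strategy_of_rule (hf₀ : IsPdf f₀) (hf₁ : IsPdf f₁) {r : ℝ × ℝ → Bool}
    (hr : Measurable r) {A : Set (ℝ × ℝ)} (hA : MeasurableSet A) :
    ∃ S : ScanStrategy, (∀ k ω, S.φ k ω = r (S.belief f₀ f₁ π₀ k ω)) ∧
      ∀ ω, S.τ ω = ⨅ (k : ℕ) (_ : S.belief f₀ f₁ π₀ k ω ∈ A), (k : ℕ∞) := by
  have hm := measurable_ruleState_scanFiltration (π₀ := π₀) hf₀ hf₁ hr
  let S : ScanStrategy :=
    { φ := ruleSwitch f₀ f₁ π₀ r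
      measurable_φ := measurable_ruleSwitch hf₀ hf₁ hr
      adapted_φ := fun k => hr.comp (hm k)
      τ := fun ω => ⨅ (k : ℕ) (_ : (ruleState f₀ f₁ π₀ r k ω).2 ∈ A), (k : ℕ∞)
      isStoppingTime_τ := isStoppingTime_iInf_mem hm hA }
  have hS (k : ℕ) (ω : Space) : S.belief f₀ f₁ π₀ k ω = (ruleState f₀ f₁ π₀ r k ω).2 := by
    induction k with
    | zero => rfl
    | succ k ih => rw [ruleState_succ_snd, ← ih]; rfl
  refine ⟨S, fun k ω => ?_, fun ω => ?_⟩
  · rw [hS]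
    rfl
  · simp only [hS]
    rfl

end Rule

/-! ### Optimality -/

section Optimality

variable {f₀ f₁ : ℝ → ℝ} {π₀ c : ℝ}

/-- The cost of going on until `τ ∧ n` and paying `V` then. -/
def truncCost (f₀ f₁ : ℝ → ℝ) (π₀ c : ℝ) (V : ℝ × ℝ → ℝ) (S : ScanStrategy) (n : ℕ) (ω : Space) :
    ℝ :=
  c * (min (S.τ ω) n).toNat + V (S.belief f₀ f₁ π₀ (min (S.τ ω) n).toNat ω)

namespace ScanStrategy

lemma measurableSet_lt_τ (S : ScanStrategy) (i : ℕ) :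
    MeasurableSet[S.F i] {ω | (i : ℕ∞) < S.τ ω} := by
  have h : MeasurableSet[S.F i] {ω | S.τ ω ≤ (i : ℕ∞)} := S.isStoppingTime_τ i
  have e : {ω | (i : ℕ∞) < S.τ ω} = {ω | S.τ ω ≤ (i : ℕ∞)}ᶜ := by
    ext ω
    simp
  rw [e]
  exact MeasurableSet.compl h

/-- One step of the dynamic programming argument. -/
lemma integral_step (hf₀ : IsPdf f₀) (hf₁ : IsPdf f₁) (h0 : 0 ≤ π₀) (h1 : π₀ ≤ 1)
    (S : ScanStrategy) {V : ℝ × ℝ → ℝ} (hV : Measurable V) {B : ℝ}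
    (hB : ∀ q ∈ simplex, |V q| ≤ B) (i : ℕ) :
    Integrable (fun ω => if (i : ℕ∞) < S.τ ω then
        c + V (S.belief f₀ f₁ π₀ (i + 1) ω) - V (S.belief f₀ f₁ π₀ i ω) else 0) (law f₀ f₁ π₀) ∧
    ∫ ω, (if (i : ℕ∞) < S.τ ω then
        c + V (S.belief f₀ f₁ π₀ (i + 1) ω) - V (S.belief f₀ f₁ π₀ i ω) else 0) ∂law f₀ f₁ π₀ =
      ∫ ω, (if (i : ℕ∞) < S.τ ω then
        c + Φc f₀ f₁ V (S.nextPrior f₀ f₁ π₀ i ω) - V (S.belief f₀ f₁ π₀ i ω) else 0)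
          ∂law f₀ f₁ π₀ := by
  have := isProbabilityMeasure_law hf₀ hf₁ h0 h1
  have hA := S.measurableSet_lt_τ i
  have hA' := S.F.le i _ hA
  have hi := S.integrable_comp_belief hf₀ hf₁ h0 h1 i hV hB
  have hi1 := S.integrable_comp_belief hf₀ hf₁ h0 h1 (i + 1) hV hB
  have hΦ := S.integrable_Φc_nextPrior hf₀ hf₁ h0 h1 i hV hB
  have hce := S.condExp_belief hf₀ hf₁ h0 h1 i hV hB
  have e (g : Space → ℝ) : (fun ω => if (i : ℕ∞) < S.τ ω then g ω else 0) =
      {ω | (i : ℕ∞) < S.τ ω}.indicator g := by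
    ext ω
    simp [Set.indicator]
  have hint : Integrable (fun ω => c + V (S.belief f₀ f₁ π₀ (i + 1) ω) -
      V (S.belief f₀ f₁ π₀ i ω)) (law f₀ f₁ π₀) := ((integrable_const c).add hi1).sub hi
  refine ⟨by rw [e]; exact hint.indicator hA', ?_⟩
  rw [e, e, integral_indicator hA', integral_indicator hA']
  -- Whether `τ` exceeds `i` is known at time `i`, so the next value may be replaced by its
  -- conditional expectation on this event.
  have hs : ∫ ω in {ω | (i : ℕ∞) < S.τ ω}, V (S.belief f₀ f₁ π₀ (i + 1) ω) ∂law f₀ f₁ π₀ =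
      ∫ ω in {ω | (i : ℕ∞) < S.τ ω}, Φc f₀ f₁ V (S.nextPrior f₀ f₁ π₀ i ω) ∂law f₀ f₁ π₀ := by
    rw [← setIntegral_condExp (S.F.le i) hi1 hA]
    exact integral_congr_ae (ae_restrict_of_ae hce)
  have hlin (g : Space → ℝ) (hg : Integrable g (law f₀ f₁ π₀)) :
      ∫ ω in {ω | (i : ℕ∞) < S.τ ω}, (c + g ω - V (S.belief f₀ f₁ π₀ i ω)) ∂law f₀ f₁ π₀ =
        ∫ _ in {ω | (i : ℕ∞) < S.τ ω}, c ∂law f₀ f₁ π₀ +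
          ∫ ω in {ω | (i : ℕ∞) < S.τ ω}, g ω ∂law f₀ f₁ π₀ -
          ∫ ω in {ω | (i : ℕ∞) < S.τ ω}, V (S.belief f₀ f₁ π₀ i ω) ∂law f₀ f₁ π₀ := by
    have hcg : Integrable (fun ω => c + g ω) (law f₀ f₁ π₀) := (integrable_const c).add hg
    rw [integral_sub hcg.integrableOn hi.integrableOn,
      integral_add (integrable_const c).integrableOn hg.integrableOn]
  rw [hlin _ hi1, hlin _ hΦ, hs]

lemma truncCost_eq (S : ScanStrategy) (V : ℝ × ℝ → ℝ) (n : ℕ) (ω : Space) :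
    truncCost f₀ f₁ π₀ c V S n ω = V (prior π₀) +
      ∑ i ∈ Finset.range n, (if (i : ℕ∞) < S.τ ω then
        c + V (S.belief f₀ f₁ π₀ (i + 1) ω) - V (S.belief f₀ f₁ π₀ i ω) else 0) := by
  rw [sum_ite_lt_eq c (fun i => V (S.belief f₀ f₁ π₀ i ω)), truncCost]
  simp only [belief]
  ring

/-- Telescoping up to `τ ∧ n` leaves the starting value plus the expected drifts. The sign of the
drift then decides both halves of the verification. -/
lemma integral_truncCost (hf₀ : IsPdf f₀) (hf₁ : IsPdf f₁) (h0 : 0 ≤ π₀) (h1 : π₀ ≤ 1)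
    (S : ScanStrategy) {V : ℝ × ℝ → ℝ} (hV : Measurable V) {B : ℝ}
    (hB : ∀ q ∈ simplex, |V q| ≤ B) (n : ℕ) :
    Integrable (truncCost f₀ f₁ π₀ c V S n) (law f₀ f₁ π₀) ∧
    ∫ ω, truncCost f₀ f₁ π₀ c V S n ω ∂law f₀ f₁ π₀ = V (prior π₀) +
      ∑ i ∈ Finset.range n, ∫ ω, (if (i : ℕ∞) < S.τ ω then
        c + Φc f₀ f₁ V (S.nextPrior f₀ f₁ π₀ i ω) - V (S.belief f₀ f₁ π₀ i ω) else 0)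
          ∂law f₀ f₁ π₀ := by
  have := isProbabilityMeasure_law hf₀ hf₁ h0 h1
  have hst := fun i => S.integral_step (c := c) hf₀ hf₁ h0 h1 hV hB i
  have hsum := integrable_finsetSum (Finset.range n) fun i _ => (hst i).1
  have e : truncCost f₀ f₁ π₀ c V S n = fun ω => V (prior π₀) +
      ∑ i ∈ Finset.range n, (if (i : ℕ∞) < S.τ ω then
        c + V (S.belief f₀ f₁ π₀ (i + 1) ω) - V (S.belief f₀ f₁ π₀ i ω) else 0) :=
    funext fun ω => S.truncCost_eq V n ω
  rw [e]
  refine ⟨(integrable_const _).add hsum, ?_⟩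
  rw [integral_add (integrable_const _) hsum, integral_finsetSum _ fun i _ => (hst i).1]
  simp [(hst _).2]

lemma ae_τ_ne_top (hc : 0 < c) {S : ScanStrategy}
    (hfin : ∫⁻ ω, ENNReal.ofReal c * (S.τ ω : ℝ≥0∞) ∂law f₀ f₁ π₀ ≠ ∞) :
    ∀ᵐ ω ∂law f₀ f₁ π₀, S.τ ω ≠ ⊤ := by
  have hm : Measurable fun ω => ENNReal.ofReal c * (S.τ ω : ℝ≥0∞) :=
    ((measurable_of_countable _).comp (measurable_of_isStoppingTime S.isStoppingTime_τ)).const_mul _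
  filter_upwards [ae_lt_top hm hfin] with ω hω h
  rw [h, ENat.toENNReal_top, ENNReal.mul_top (by simpa using hc)] at hω
  exact lt_irrefl _ hω

/-- The cost of going on until `τ` and paying `V` then. -/
def totalCost (f₀ f₁ : ℝ → ℝ) (π₀ c : ℝ) (V : ℝ × ℝ → ℝ) (S : ScanStrategy) (ω : Space) : ℝ :=
  c * (S.τ ω).toNat + V (S.belief f₀ f₁ π₀ (S.τ ω).toNat ω)

/-- Where `τ` is finite the truncated costs are eventually constant, and finiteness of the expected
observation cost makes `c τ + B` an integrable bound. -/
lemma tendsto_truncCost (hf₀ : IsPdf f₀) (hf₁ : IsPdf f₁) (h0 : 0 ≤ π₀) (h1 : π₀ ≤ 1) (hc : 0 < c)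
    {S : ScanStrategy} (hfin : ∫⁻ ω, ENNReal.ofReal c * (S.τ ω : ℝ≥0∞) ∂law f₀ f₁ π₀ ≠ ∞)
    {V : ℝ × ℝ → ℝ} (hV : Measurable V) {B : ℝ} (hB : ∀ q ∈ simplex, |V q| ≤ B) :
    Integrable (totalCost f₀ f₁ π₀ c V S) (law f₀ f₁ π₀) ∧
    Filter.Tendsto (fun n => ∫ ω, truncCost f₀ f₁ π₀ c V S n ω ∂law f₀ f₁ π₀) Filter.atTop
      (nhds (∫ ω, totalCost f₀ f₁ π₀ c V S ω ∂law f₀ f₁ π₀)) := by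
  have := isProbabilityMeasure_law hf₀ hf₁ h0 h1
  have hτ := measurable_of_isStoppingTime S.isStoppingTime_τ
  have htop := ae_τ_ne_top hc hfin
  have hN : Measurable fun ω => c * ((S.τ ω).toNat : ℝ) :=
    ((measurable_of_countable fun t : ℕ∞ => (t.toNat : ℝ)).comp hτ).const_mul c
  have hNi : Integrable (fun ω => c * ((S.τ ω).toNat : ℝ)) (law f₀ f₁ π₀) := by
    refine ⟨hN.aestronglyMeasurable, ?_⟩
    rw [hasFiniteIntegral_iff_ofReal (Filter.Eventually.of_forall fun ω => by positivity)]
    refine lt_of_le_of_lt (lintegral_mono fun ω => ?_) (lt_top_iff_ne_top.2 hfin)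
    rw [ENNReal.ofReal_mul hc.le, ENNReal.ofReal_natCast]
    gcongr
    rw [← ENat.toENNReal_coe]
    exact ENat.toENNReal_le.2 (ENat.natCast_toNat_le_self _)
  have hbi : Integrable (fun ω => c * ((S.τ ω).toNat : ℝ) + B) (law f₀ f₁ π₀) :=
    hNi.add (integrable_const B)
  have hmeas := fun n =>
    (S.integral_truncCost (c := c) hf₀ hf₁ h0 h1 hV hB n).1.aestronglyMeasurable
  have hlim : ∀ᵐ ω ∂law f₀ f₁ π₀, Filter.Tendsto (fun n => truncCost f₀ f₁ π₀ c V S n ω)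
      Filter.atTop (nhds (totalCost f₀ f₁ π₀ c V S ω)) := by
    filter_upwards [htop] with ω hω
    refine tendsto_const_nhds.congr' ?_
    filter_upwards [Filter.eventually_ge_atTop (S.τ ω).toNat] with n hn
    have : S.τ ω ≤ n := by
      rw [← ENat.natCast_toNat hω]
      exact Nat.cast_le.2 hn
    rw [truncCost, totalCost, min_eq_left this]
  have habs (t : ℕ) (ω : Space) : |c * (t : ℝ) + V (S.belief f₀ f₁ π₀ t ω)| ≤ c * t + B := by
    refine (abs_add_le _ _).trans (add_le_add ?_ (hB _ (S.belief_mem_simplex hf₀ hf₁ h0 h1 t ω)))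
    rw [abs_of_nonneg (by positivity)]
  refine ⟨hbi.mono' (aestronglyMeasurable_of_tendsto_ae Filter.atTop hmeas hlim)
    (Filter.Eventually.of_forall fun ω => habs _ ω), ?_⟩
  refine tendsto_integral_of_dominated_convergence _ hmeas hbi (fun n => ?_) hlim
  filter_upwards [htop] with ω hω
  refine (habs _ ω).trans ?_
  gcongr
  exact min_le_left _ _

lemma scanCost_eq (hf₀ : IsPdf f₀) (hf₁ : IsPdf f₁) (h0 : 0 ≤ π₀) (h1 : π₀ ≤ 1) (hc : 0 < c)
    (hv : IsUnitCost (v f₀ f₁ c))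
    {S : ScanStrategy} (hfin : ∫⁻ ω, ENNReal.ofReal c * (S.τ ω : ℝ≥0∞) ∂law f₀ f₁ π₀ ≠ ∞) :
    scanCost f₀ f₁ π₀ c S = ENNReal.ofReal
      (∫ ω, totalCost f₀ f₁ π₀ c (simplex.indicator (v f₀ f₁ c)) S ω ∂law f₀ f₁ π₀) := by
  have e : ∀ q ∈ simplex, simplex.indicator (v f₀ f₁ c) q = v f₀ f₁ c q :=
    fun q hq => Set.indicator_of_mem hq _
  have hB : ∀ q ∈ simplex, |simplex.indicator (v f₀ f₁ c) q| ≤ 1 := fun q hq => by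
    rw [e q hq, abs_of_nonneg (hv.nonneg q hq)]
    exact hv.le_one q hq
  have hb := S.belief_mem_simplex (f₀ := f₀) (f₁ := f₁) (π₀ := π₀) hf₀ hf₁ h0 h1
  have hi := (tendsto_truncCost hf₀ hf₁ h0 h1 hc hfin
    (measurable_indicator_simplex hv.measurable) hB).1
  have hnn (ω : Space) : 0 ≤ totalCost f₀ f₁ π₀ c (simplex.indicator (v f₀ f₁ c)) S ω := by
    rw [totalCost, e _ (hb _ ω)]
    have := hv.nonneg _ (hb (S.τ ω).toNat ω)
    positivity
  rw [ofReal_integral_eq_lintegral_ofReal hi (Filter.Eventually.of_forall hnn), scanCost]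
  refine lintegral_congr_ae ?_
  filter_upwards [ae_τ_ne_top hc hfin, S.ae_posterior_eq hf₀ hf₁ h0 h1] with ω hω hp
  have hτ := ENat.natCast_toNat hω
  rw [totalCost, stoppedValue_of_eq hτ.symm, hp, e _ (hb _ ω),
    ENNReal.ofReal_add (by positivity) (hv.nonneg _ (hb _ ω)), ENNReal.ofReal_mul hc.le,
    ENNReal.ofReal_natCast]
  conv_lhs => rw [← hτ, ENat.toENNReal_coe]
  simp

end ScanStrategy

/-! ### Verification: the lower bound and its attainment -/

variable {U : ℝ × ℝ → ℝ}

/-- The facts about the extension by zero of a solution. -/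
lemma IsSolution.exists_extension (hf₀ : IsPdf f₀) (hf₁ : IsPdf f₁) (h0 : 0 ≤ π₀) (h1 : π₀ ≤ 1)
    (hU : IsSolution f₀ f₁ π₀ c U) :
    ∃ V : ℝ × ℝ → ℝ, Measurable V ∧ (∃ B, ∀ p ∈ simplex, |V p| ≤ B) ∧
      (∀ p ∈ simplex, V p = U p) ∧ (∀ p ∈ simplex, Φc f₀ f₁ U p = Φc f₀ f₁ V p) ∧
      Φs f₀ f₁ π₀ U = Φs f₀ f₁ π₀ V := by
  obtain ⟨B, hB⟩ := hU.bounded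
  have e : ∀ q ∈ simplex, simplex.indicator U q = U q := fun q hq => Set.indicator_of_mem hq _
  have hΦ : ∀ p ∈ simplex, Φc f₀ f₁ U p = Φc f₀ f₁ (simplex.indicator U) p :=
    fun p hp => Φc_congr hf₀ hf₁ hp fun q hq => (e q hq).symm
  exact ⟨_, measurable_indicator_simplex hU.measurable,
    ⟨B, fun p hp => by rw [e p hp]; exact hB p hp⟩, e, hΦ, hΦ _ (prior_mem_simplex h0 h1)⟩

lemma exists_optimal_rule (hf₀ : IsPdf f₀) (hf₁ : IsPdf f₁) (h0 : 0 ≤ π₀) (h1 : π₀ ≤ 1)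
    (hv : IsUnitCost (v f₀ f₁ c)) (hU : IsSolution f₀ f₁ π₀ c U) :
    ∃ S : ScanStrategy, StopsByRule f₀ f₁ π₀ c U S ∧ SwitchesByRule f₀ f₁ π₀ U S := by
  obtain ⟨V, hVm, -, hVU, hΦ, hΦs⟩ := hU.exists_extension hf₀ hf₁ h0 h1
  -- The value `true` means a switch, so the strict inequality makes ties continue.
  have hr : Measurable fun p => decide (Φs f₀ f₁ π₀ V < Φc f₀ f₁ V p) := by
    refine measurable_to_bool ?_
    have : (fun p => decide (Φs f₀ f₁ π₀ V < Φc f₀ f₁ V p)) ⁻¹' {true} =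
        {p | Φs f₀ f₁ π₀ V < Φc f₀ f₁ V p} := by
      ext p
      simp
    rw [this]
    exact measurableSet_lt measurable_const (measurable_Φc hf₀ hf₁ hVm)
  obtain ⟨S, hS1, hS2⟩ := exists_strategy_of_rule (π₀ := π₀) hf₀ hf₁ hr
    (measurableSet_eq_fun (measurable_indicator_simplex hv.measurable) hVm)
  have hb := S.belief_mem_simplex (f₀ := f₀) (f₁ := f₁) (π₀ := π₀) hf₀ hf₁ h0 h1
  refine ⟨S, ?_, ?_⟩
  · filter_upwards [S.ae_posterior_eq hf₀ hf₁ h0 h1] with ω hω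
    rw [hS2]
    refine iInf_congr fun k => ?_
    rw [hω, ← hVU _ (hb k ω)]
    simp only [Set.mem_ofPred_eq, Set.indicator_of_mem (hb k ω)]
  · filter_upwards [S.ae_posterior_eq hf₀ hf₁ h0 h1] with ω hω k
    rw [hS1, hω, hΦ _ (hb k ω), hΦs]
    simp

/-- No strategy costs less than the value of the solution at the prior. -/
lemma ofReal_le_scanCost (hf₀ : IsPdf f₀) (hf₁ : IsPdf f₁) (h0 : 0 ≤ π₀) (h1 : π₀ ≤ 1)
    (hc : 0 < c) (hv : IsUnitCost (v f₀ f₁ c)) (hU : IsSolution f₀ f₁ π₀ c U)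
    (S : ScanStrategy) : ENNReal.ofReal (U (prior π₀)) ≤ scanCost f₀ f₁ π₀ c S := by
  by_cases hfin : ∫⁻ ω, ENNReal.ofReal c * (S.τ ω : ℝ≥0∞) ∂law f₀ f₁ π₀ = ∞
  · refine le_trans le_top (hfin.symm.le.trans ?_)
    exact lintegral_mono fun ω => le_self_add
  obtain ⟨V, hVm, ⟨B, hB⟩, hVU, hΦ, hΦs⟩ := hU.exists_extension hf₀ hf₁ h0 h1
  have hb := S.belief_mem_simplex (f₀ := f₀) (f₁ := f₁) (π₀ := π₀) hf₀ hf₁ h0 h1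
  have hvB : ∀ q ∈ simplex, |simplex.indicator (v f₀ f₁ c) q| ≤ 1 := fun q hq => by
    rw [Set.indicator_of_mem hq, abs_of_nonneg (hv.nonneg q hq)]
    exact hv.le_one q hq
  rw [S.scanCost_eq hf₀ hf₁ h0 h1 hc hv hfin]
  refine ENNReal.ofReal_le_ofReal ?_
  obtain ⟨hi1, hlim⟩ := S.tendsto_truncCost hf₀ hf₁ h0 h1 hc hfin hVm hB
  obtain ⟨hi2, -⟩ := S.tendsto_truncCost hf₀ hf₁ h0 h1 hc hfin
    (measurable_indicator_simplex hv.measurable) hvB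
  have hstep : U (prior π₀) ≤ ∫ ω, S.totalCost f₀ f₁ π₀ c V ω ∂law f₀ f₁ π₀ := by
    refine ge_of_tendsto' hlim fun n => ?_
    rw [(S.integral_truncCost hf₀ hf₁ h0 h1 hVm hB n).2, hVU _ (prior_mem_simplex h0 h1)]
    refine le_add_of_nonneg_right (Finset.sum_nonneg fun i _ => integral_nonneg fun ω => ?_)
    simp only [Pi.zero_apply]
    split_ifs
    -- Since `U` is at most `c` plus the smaller of the two expected values, the drift is
    -- nonnegative for either decision.
    · have h2 := (hU.eq_min _ (hb i ω)).le.trans (min_le_right _ _)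
      rw [hΦ _ (hb i ω), hΦs, ← hVU _ (hb i ω), Φs_eq] at h2
      have h3 := min_le_left (Φc f₀ f₁ V (S.belief f₀ f₁ π₀ i ω)) (Φc f₀ f₁ V (prior π₀))
      have h4 := min_le_right (Φc f₀ f₁ V (S.belief f₀ f₁ π₀ i ω)) (Φc f₀ f₁ V (prior π₀))
      unfold ScanStrategy.nextPrior
      split_ifs <;> linarith
    · exact le_rfl
  -- The strategy pays `v` at the end, which is at least `U`.
  refine hstep.trans (integral_mono hi1 hi2 fun ω => ?_)
  rw [ScanStrategy.totalCost, ScanStrategy.totalCost, hVU _ (hb _ ω),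
    Set.indicator_of_mem (hb _ ω)]
  exact add_le_add_right ((hU.eq_min _ (hb _ ω)).le.trans (min_le_left _ _)) _

/-- A strategy that follows the rules costs as much as the value of the solution at the prior. -/
lemma scanCost_eq_of_rule (hf₀ : IsPdf f₀) (hf₁ : IsPdf f₁) (h0 : 0 ≤ π₀) (h1 : π₀ ≤ 1)
    (hc : 0 < c) (hv : IsUnitCost (v f₀ f₁ c)) (hU : IsSolution f₀ f₁ π₀ c U)
    {S : ScanStrategy} (hS1 : StopsByRule f₀ f₁ π₀ c U S) (hS2 : SwitchesByRule f₀ f₁ π₀ U S) :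
    scanCost f₀ f₁ π₀ c S = ENNReal.ofReal (U (prior π₀)) := by
  have := isProbabilityMeasure_law hf₀ hf₁ h0 h1
  obtain ⟨V, hVm, ⟨B, hB⟩, hVU, hΦ, hΦs⟩ := hU.exists_extension hf₀ hf₁ h0 h1
  have hb := S.belief_mem_simplex (f₀ := f₀) (f₁ := f₁) (π₀ := π₀) hf₀ hf₁ h0 h1
  have hpost := S.ae_posterior_eq hf₀ hf₁ h0 h1
  have hzero (i : ℕ) : ∫ ω, (if (i : ℕ∞) < S.τ ω then
        c + Φc f₀ f₁ V (S.nextPrior f₀ f₁ π₀ i ω) - V (S.belief f₀ f₁ π₀ i ω) else 0)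
          ∂law f₀ f₁ π₀ = 0 := by
    refine integral_eq_zero_of_ae ?_
    filter_upwards [hS1, hS2, hpost] with ω hτ hφ hp
    simp only [Pi.zero_apply]
    split_ifs with hi
    -- Before `τ` stopping is not optimal, so `U` is the continuation term of the minimum; the
    -- switching rule selects exactly the smaller of `Φc` and `Φs`, and the drift vanishes.
    · have hne : v f₀ f₁ c (S.belief f₀ f₁ π₀ i ω) ≠ U (S.belief f₀ f₁ π₀ i ω) := by
        rw [hτ] at hi
        have := notMem_of_lt_iInf (u := fun k => S.posterior f₀ f₁ π₀ k ω)
          (A := {p | v f₀ f₁ c p = U p}) hi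
        rwa [Set.mem_ofPred_eq, hp] at this
      have h2 := hU.eq_min _ (hb i ω)
      rcases min_choice (v f₀ f₁ c (S.belief f₀ f₁ π₀ i ω))
        (c + min (Φc f₀ f₁ U (S.belief f₀ f₁ π₀ i ω)) (Φs f₀ f₁ π₀ U)) with h3 | h3
      · exact absurd (h2.trans h3).symm hne
      · have h4 := h2.trans h3
        have h5 := hφ i
        rw [hp] at h5
        rw [hΦ _ (hb i ω), hΦs] at h4 h5
        rw [hVU _ (hb i ω), h4]
        unfold ScanStrategy.nextPrior
        by_cases h6 : S.φ i ω = true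
        · have h7 : ¬ Φc f₀ f₁ V (S.belief f₀ f₁ π₀ i ω) ≤ Φs f₀ f₁ π₀ V := fun h => by
            simp [h5.2 h] at h6
          rw [if_pos h6, min_eq_right (not_le.1 h7).le, Φs_eq]
          ring
        · rw [if_neg h6, min_eq_left (h5.1 (Bool.not_eq_true _ ▸ h6))]
          ring
    · rfl
  have hconst (n : ℕ) : ∫ ω, truncCost f₀ f₁ π₀ c V S n ω ∂law f₀ f₁ π₀ = U (prior π₀) := by
    rw [(S.integral_truncCost hf₀ hf₁ h0 h1 hVm hB n).2, hVU _ (prior_mem_simplex h0 h1),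
      Finset.sum_eq_zero fun i _ => hzero i, add_zero]
  -- Finite expected duration is derived, not assumed: the constant truncated cost and the bound `-B
  -- ≤ V` give `c E[τ ∧ n] ≤ U (prior π₀) + B` for all `n`, and monotone convergence removes the
  -- truncation.
  have hfin : ∫⁻ ω, ENNReal.ofReal c * (S.τ ω : ℝ≥0∞) ∂law f₀ f₁ π₀ ≠ ∞ := by
    have hτ := measurable_of_isStoppingTime S.isStoppingTime_τ
    have hm (n : ℕ) : Measurable fun ω => ENNReal.ofReal c * ((min (S.τ ω) n : ℕ∞) : ℝ≥0∞) :=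
      ((measurable_of_countable fun t : ℕ∞ => ((min t n : ℕ∞) : ℝ≥0∞)).comp hτ).const_mul _
    have hsup (ω : Space) : ENNReal.ofReal c * (S.τ ω : ℝ≥0∞) =
        ⨆ n : ℕ, ENNReal.ofReal c * ((min (S.τ ω) n : ℕ∞) : ℝ≥0∞) := by
      rw [← ENNReal.mul_iSup]
      congr 1
      refine le_antisymm ?_ (iSup_le fun n => ENat.toENNReal_le.2 (min_le_left _ _))
      induction S.τ ω with
      | top =>
        have h (n : ℕ) : ((min (⊤ : ℕ∞) n : ℕ∞) : ℝ≥0∞) = n := by simp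
        simp only [h, ENNReal.iSup_natCast]
        exact le_top
      | coe m => exact le_iSup_of_le m (by simp)
    have hmono : Monotone fun (n : ℕ) ω => ENNReal.ofReal c * ((min (S.τ ω) n : ℕ∞) : ℝ≥0∞) := by
      intro m n hmn ω
      have : (min (S.τ ω) m : ℕ∞) ≤ min (S.τ ω) n := min_le_min_left _ (Nat.cast_le.2 hmn)
      exact mul_le_mul_right (ENat.toENNReal_le.2 this) _
    simp only [hsup]
    rw [lintegral_iSup hm hmono]
    refine ne_top_of_le_ne_top (ENNReal.ofReal_ne_top (r := U (prior π₀) + B))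
      (iSup_le fun n => ?_)
    have hi := (S.integral_truncCost (c := c) hf₀ hf₁ h0 h1 hVm hB n).1
    have hle (ω : Space) : c * ((min (S.τ ω) n).toNat : ℝ) ≤ truncCost f₀ f₁ π₀ c V S n ω + B := by
      have := (abs_le.1 (hB _ (hb (min (S.τ ω) n).toNat ω))).1
      rw [truncCost]
      linarith
    have hnn (ω : Space) : 0 ≤ truncCost f₀ f₁ π₀ c V S n ω + B :=
      le_trans (by positivity) (hle ω)
    have he : ∫ ω, (truncCost f₀ f₁ π₀ c V S n ω + B) ∂law f₀ f₁ π₀ = U (prior π₀) + B := by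
      rw [integral_add hi (integrable_const B), hconst]
      simp
    have hiB : Integrable (fun ω => truncCost f₀ f₁ π₀ c V S n ω + B) (law f₀ f₁ π₀) :=
      hi.add (integrable_const B)
    rw [← he, ofReal_integral_eq_lintegral_ofReal hiB (Filter.Eventually.of_forall hnn)]
    refine lintegral_mono fun ω => ?_
    refine le_trans (le_of_eq ?_) (ENNReal.ofReal_le_ofReal (hle ω))
    have hnt : min (S.τ ω) n ≠ ⊤ := ne_top_of_le_ne_top (ENat.natCast_ne_top n) (min_le_right _ _)
    rw [ENNReal.ofReal_mul hc.le, ENNReal.ofReal_natCast, ← ENat.toENNReal_coe,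
      ENat.natCast_toNat hnt]
  rw [S.scanCost_eq hf₀ hf₁ h0 h1 hc hv hfin]
  congr 1
  obtain ⟨-, hlim⟩ := S.tendsto_truncCost hf₀ hf₁ h0 h1 hc hfin hVm hB
  simp only [hconst] at hlim
  rw [tendsto_nhds_unique tendsto_const_nhds hlim]
  refine integral_congr_ae ?_
  filter_upwards [hS1, hpost, ScanStrategy.ae_τ_ne_top hc hfin] with ω hτ hp htop
  -- As `τ` is almost surely finite, its defining infimum is attained, so paying `V` and paying `v`
  -- agree at `τ`.
  have := iInf_mem_of_eq (u := fun k => S.posterior f₀ f₁ π₀ k ω) (A := {p | v f₀ f₁ c p = U p})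
    (hτ.symm.trans (ENat.natCast_toNat htop).symm)
  rw [Set.mem_ofPred_eq, hp] at this
  rw [ScanStrategy.totalCost, ScanStrategy.totalCost, hVU _ (hb _ ω),
    Set.indicator_of_mem (hb _ ω), this]

end Optimality

/-! ### The value of the refinement stage -/

lemma condExp_indicator_bounds {α : Type*} {m mα : MeasurableSpace α} (hm : m ≤ mα)
    {μ : Measure α} [IsProbabilityMeasure μ] {E : Set α} (hE : MeasurableSet E) :
    ∀ᵐ ω ∂μ, 0 ≤ (μ[E.indicator (fun _ => (1 : ℝ)) | m]) ω ∧
      (μ[E.indicator (fun _ => (1 : ℝ)) | m]) ω ≤ 1 := by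
  have hi : Integrable (E.indicator (fun _ => (1 : ℝ))) μ := (integrable_const _).indicator hE
  have h1 := condExp_nonneg (μ := μ) (m := m) (f := E.indicator (fun _ => (1 : ℝ)))
    (Filter.Eventually.of_forall (Set.indicator_nonneg fun _ _ => zero_le_one))
  have h2 := condExp_mono (μ := μ) (m := m) hi (integrable_const (1 : ℝ))
    (Filter.Eventually.of_forall (Set.indicator_le_self' fun _ _ => zero_le_one))
  rw [condExp_const hm] at h2
  filter_upwards [h1, h2] with ω h3 h4 using ⟨h3, h4⟩

lemma setLIntegral_one_sub_condExp {α : Type*} {m mα : MeasurableSpace α} (hm : m ≤ mα)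
    {μ : Measure α} [IsProbabilityMeasure μ] {E A : Set α} (hE : MeasurableSet E)
    (hA : MeasurableSet[m] A) :
    ∫⁻ ω in A, ENNReal.ofReal (1 - E.indicator (fun _ => (1 : ℝ)) ω) ∂μ =
      ∫⁻ ω in A, ENNReal.ofReal (1 - (μ[E.indicator (fun _ => (1 : ℝ)) | m]) ω) ∂μ := by
  have hi : Integrable (E.indicator (fun _ => (1 : ℝ))) μ := (integrable_const _).indicator hE
  have h1 : Integrable (fun _ : α => (1 : ℝ)) μ := integrable_const 1
  have hle : ∀ ω, E.indicator (fun _ => (1 : ℝ)) ω ≤ 1 :=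
    Set.indicator_le_self' fun _ _ => zero_le_one
  have h2 : Integrable (fun ω => 1 - E.indicator (fun _ => (1 : ℝ)) ω) μ := h1.sub hi
  have h3 : Integrable (fun ω => 1 - (μ[E.indicator (fun _ => (1 : ℝ)) | m]) ω) μ :=
    h1.sub integrable_condExp
  rw [← ofReal_integral_eq_lintegral_ofReal h2.integrableOn
      (Filter.Eventually.of_forall fun ω => sub_nonneg.2 (hle ω)),
    ← ofReal_integral_eq_lintegral_ofReal h3.integrableOn (ae_restrict_of_ae
      ((condExp_indicator_bounds hm hE).mono fun ω h => sub_nonneg.2 h.2)),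
    integral_sub h1.integrableOn hi.integrableOn,
    integral_sub h1.integrableOn integrable_condExp.integrableOn, setIntegral_condExp hm hi hA]

/-! ### Measurability of the refinement value by decision rules -/

section Refine

variable {f₀ f₁ : ℝ → ℝ} {c : ℝ}

/-- The law of the refinement stage, given the types of the candidates. -/
def typedLaw (f₀ f₁ : ℝ → ℝ) (h : Bool × Bool) : Measure RefineSpace :=
  (Measure.dirac h).prod (samplesLaw f₀ f₁ h.1)

lemma isProbabilityMeasure_typedLaw (hf₀ : IsPdf f₀) (hf₁ : IsPdf f₁) (h : Bool × Bool) :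
    IsProbabilityMeasure (typedLaw f₀ f₁ h) := by
  have := isProbabilityMeasure_samplesLaw hf₀ hf₁ h.1
  unfold typedLaw
  infer_instance

lemma lintegral_refineLaw (r : Bool × Bool → ℝ) (F : RefineSpace → ℝ≥0∞) :
    ∫⁻ ω, F ω ∂refineLaw f₀ f₁ r =
      ∑ h, ENNReal.ofReal (r h) * ∫⁻ ω, F ω ∂typedLaw f₀ f₁ h := by
  have : refineLaw f₀ f₁ r = ∑ h, ENNReal.ofReal (r h) • typedLaw f₀ f₁ h := rfl
  rw [this, lintegral_finsetSum_measure]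
  simp only [lintegral_smul_measure, smul_eq_mul]

lemma isProbabilityMeasure_refineLaw (hf₀ : IsPdf f₀) (hf₁ : IsPdf f₁) {p : ℝ × ℝ}
    (hp : p ∈ simplex) : IsProbabilityMeasure (refineLaw f₀ f₁ (initialWeights p)) := by
  have := isProbabilityMeasure_typedLaw hf₀ hf₁
  constructor
  rw [← lintegral_one, lintegral_refineLaw]
  simp [sum_ofReal_initialWeights hp]

/-- The event that the first candidate is of type `1`. -/
def firstEvent : Set RefineSpace := {ω | ω.1.1 = true}

/-- The event that the second candidate is of type `1`. -/
def secondEvent : Set RefineSpace := {ω | ω.1.2 = true}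

lemma measurableSet_firstEvent : MeasurableSet firstEvent :=
  (measurable_fst.comp measurable_fst) (measurableSet_singleton true)

lemma measurableSet_secondEvent : MeasurableSet secondEvent :=
  (measurable_snd.comp measurable_fst) (measurableSet_singleton true)

/-- Cost of stopping at `τ` and choosing the first candidate on `D τ`, the second one elsewhere,
when the loss of the two choices at time `j` is `a j` and `b j`. -/
def decisionCost (c : ℝ) (τ : RefineSpace → ℕ∞) (D : ℕ → Set RefineSpace)
    (a b : ℕ → RefineSpace → ℝ) (ω : RefineSpace) : ℝ≥0∞ :=
  open scoped Classical in
  ENNReal.ofReal c * (τ ω : ℝ≥0∞) +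
    if ω ∈ D (τ ω).toNat then ENNReal.ofReal (1 - a (τ ω).toNat ω)
    else ENNReal.ofReal (1 - b (τ ω).toNat ω)

lemma measurable_eval_toNat {τ : RefineSpace → ℕ∞} (hτ : IsStoppingTime G τ)
    {F : ℕ → RefineSpace → ℝ≥0∞} (hF : ∀ j, Measurable (F j)) :
    Measurable fun ω => F (τ ω).toNat ω :=
  (measurable_from_prod_countable_right (f := fun x : ℕ × RefineSpace => F x.1 x.2) hF).comp
    (((measurable_of_countable ENat.toNat).comp (measurable_of_isStoppingTime hτ)).prodMk
      measurable_id)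

open scoped Classical in
lemma measurable_choice {τ : RefineSpace → ℕ∞} (hτ : IsStoppingTime G τ)
    {D : ℕ → Set RefineSpace} (hD : ∀ j, MeasurableSet[G j] (D j)) {a b : ℕ → RefineSpace → ℝ}
    (ha : ∀ j, Measurable (a j)) (hb : ∀ j, Measurable (b j)) :
    Measurable fun ω => if ω ∈ D (τ ω).toNat then ENNReal.ofReal (1 - a (τ ω).toNat ω)
      else ENNReal.ofReal (1 - b (τ ω).toNat ω) :=
  measurable_eval_toNat hτ (F := fun j ω => if ω ∈ D j then ENNReal.ofReal (1 - a j ω)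
      else ENNReal.ofReal (1 - b j ω)) fun j =>
    Measurable.ite (G.le j _ (hD j)) (measurable_const.sub (ha j)).ennreal_ofReal
      (measurable_const.sub (hb j)).ennreal_ofReal

/-- The expected loss of a decision does not change if the losses are replaced by their
conditional expectations. -/
lemma lintegral_decisionCost (hf₀ : IsPdf f₀) (hf₁ : IsPdf f₁) {p : ℝ × ℝ} (hp : p ∈ simplex)
    {τ : RefineSpace → ℕ∞} (hτ : IsStoppingTime G τ) (htop : ∀ ω, τ ω ≠ ⊤)
    {D : ℕ → Set RefineSpace} (hD : ∀ j, MeasurableSet[G j] (D j)) :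
    ∫⁻ ω, decisionCost c τ D (fun _ => firstEvent.indicator fun _ => 1)
        (fun _ => secondEvent.indicator fun _ => 1) ω ∂refineLaw f₀ f₁ (initialWeights p) =
      ∫⁻ ω, decisionCost c τ D (q₁ f₀ f₁ (initialWeights p)) (q₂ f₀ f₁ (initialWeights p)) ω
        ∂refineLaw f₀ f₁ (initialWeights p) := by
  classical
  have := isProbabilityMeasure_refineLaw hf₀ hf₁ hp
  set μ := refineLaw f₀ f₁ (initialWeights p) with hμ
  have hτm := measurable_of_isStoppingTime hτ
  have hmc : Measurable fun ω => ENNReal.ofReal c * (τ ω : ℝ≥0∞) :=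
    ((measurable_of_countable _).comp hτm).const_mul _
  have hq1 (j : ℕ) : Measurable (q₁ f₀ f₁ (initialWeights p) j) :=
    (stronglyMeasurable_condExp.mono (G.le j)).measurable
  have hq2 (j : ℕ) : Measurable (q₂ f₀ f₁ (initialWeights p) j) :=
    (stronglyMeasurable_condExp.mono (G.le j)).measurable
  have hi1 : Measurable (firstEvent.indicator fun _ => (1 : ℝ)) :=
    measurable_const.indicator measurableSet_firstEvent
  have hi2 : Measurable (secondEvent.indicator fun _ => (1 : ℝ)) :=
    measurable_const.indicator measurableSet_secondEvent
  simp only [decisionCost]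
  rw [lintegral_add_left hmc, lintegral_add_left hmc]
  congr 1
  -- On `{τ = m}` the decision splits the event into two parts that belong to `G m`, so the defining
  -- property of conditional expectation applies to each.
  refine lintegral_congr_of_fibers ((measurable_of_countable ENat.toNat).comp hτm)
    (measurable_choice hτ hD (fun _ => hi1) fun _ => hi2) (measurable_choice hτ hD hq1 hq2)
    fun m => ?_
  have hA : MeasurableSet[G m] {ω | τ ω = (m : ℕ∞)} := hτ.measurableSet_eq_of_countable m
  have e (x y : RefineSpace → ℝ≥0∞) (ω : RefineSpace) (u w : ℕ → RefineSpace → ℝ)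
      (hx : x ω = ENNReal.ofReal (1 - u m ω)) (hy : y ω = ENNReal.ofReal (1 - w m ω)) :
      (if (ENat.toNat ∘ τ) ω = m then
        if ω ∈ D (τ ω).toNat then ENNReal.ofReal (1 - u (τ ω).toNat ω)
        else ENNReal.ofReal (1 - w (τ ω).toNat ω) else 0) =
      ({ω | τ ω = (m : ℕ∞)} ∩ D m).indicator x ω + ({ω | τ ω = (m : ℕ∞)} \ D m).indicator y ω := by
    -- This is where `htop` enters: `toNat` sends `⊤` to `0` and would confuse the two times.
    have hiff : (τ ω).toNat = m ↔ τ ω = (m : ℕ∞) := by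
      rw [← ENat.natCast_toNat (htop ω), Nat.cast_inj, ENat.toNat_natCast]
    by_cases h1 : (τ ω).toNat = m
    · have h2 := hiff.1 h1
      by_cases h3 : ω ∈ D m <;> simp [h2, h3, hx, hy]
    · have h2 : ω ∉ {ω | τ ω = (m : ℕ∞)} := fun h => h1 (hiff.2 h)
      rw [Set.indicator_of_notMem fun h => h2 h.1, Set.indicator_of_notMem fun h => h2 h.1,
        Function.comp_apply, if_neg h1, add_zero]
  have hAD : MeasurableSet[G m] ({ω | τ ω = (m : ℕ∞)} ∩ D m) := hA.inter (hD m)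
  have hAD' : MeasurableSet[G m] ({ω | τ ω = (m : ℕ∞)} \ D m) := hA.diff (hD m)
  have hadd {a b : RefineSpace → ℝ} (ha : Measurable a) :
      ∫⁻ ω, (({ω | τ ω = (m : ℕ∞)} ∩ D m).indicator (fun ω => ENNReal.ofReal (1 - a ω)) ω +
        ({ω | τ ω = (m : ℕ∞)} \ D m).indicator (fun ω => ENNReal.ofReal (1 - b ω)) ω) ∂μ =
      ∫⁻ ω in {ω | τ ω = (m : ℕ∞)} ∩ D m, ENNReal.ofReal (1 - a ω) ∂μ +
        ∫⁻ ω in {ω | τ ω = (m : ℕ∞)} \ D m, ENNReal.ofReal (1 - b ω) ∂μ := by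
    have ha' : Measurable fun ω => ENNReal.ofReal (1 - a ω) :=
      (measurable_const.sub ha).ennreal_ofReal
    rw [lintegral_add_left (ha'.indicator (G.le m _ hAD)),
      lintegral_indicator (G.le m _ hAD), lintegral_indicator (G.le m _ hAD')]
  rw [lintegral_congr fun ω => e (fun ω => ENNReal.ofReal (1 - firstEvent.indicator (fun _ => 1) ω))
      (fun ω => ENNReal.ofReal (1 - secondEvent.indicator (fun _ => 1) ω)) ω
      (fun _ => firstEvent.indicator fun _ => 1) (fun _ => secondEvent.indicator fun _ => 1)
      rfl rfl,
    lintegral_congr fun ω => e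
      (fun ω => ENNReal.ofReal (1 - q₁ f₀ f₁ (initialWeights p) m ω))
      (fun ω => ENNReal.ofReal (1 - q₂ f₀ f₁ (initialWeights p) m ω)) ω
      (q₁ f₀ f₁ (initialWeights p)) (q₂ f₀ f₁ (initialWeights p)) rfl rfl,
    hadd hi1,
    hadd (hq1 m),
    setLIntegral_one_sub_condExp (G.le m) measurableSet_firstEvent hAD,
    setLIntegral_one_sub_condExp (G.le m) measurableSet_secondEvent hAD']
  rfl

/-- The stopping times bounded by a constant, with decision rules. -/
def DecisionRule : Type :=
  {x : (RefineSpace → ℕ∞) × (ℕ → Set RefineSpace) // IsStoppingTime G x.1 ∧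
    (∃ N : ℕ, ∀ ω, x.1 ω ≤ N) ∧ ∀ j, MeasurableSet[G j] (x.2 j)}

/-- The cost of a decision rule, linear in the weights of the types. -/
def ruleCost (f₀ f₁ : ℝ → ℝ) (c : ℝ) (x : DecisionRule) (p : ℝ × ℝ) : ℝ≥0∞ :=
  ∫⁻ ω, decisionCost c x.1.1 x.1.2 (fun _ => firstEvent.indicator fun _ => 1)
    (fun _ => secondEvent.indicator fun _ => 1) ω ∂refineLaw f₀ f₁ (initialWeights p)

/-- A rule is fixed independently of `p`, so `p` enters only through the weights of the four types.
Boundedness of the stopping time keeps their coefficients finite. -/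
lemma continuous_ruleCost (hf₀ : IsPdf f₀) (hf₁ : IsPdf f₁) (x : DecisionRule) :
    Continuous (ruleCost f₀ f₁ c x) := by
  have := isProbabilityMeasure_typedLaw hf₀ hf₁
  obtain ⟨x, hτ, ⟨N, hN⟩, hD⟩ := x
  have e := fun p => lintegral_refineLaw (f₀ := f₀) (f₁ := f₁) (initialWeights p)
    (decisionCost c x.1 x.2 (fun _ => firstEvent.indicator fun _ => 1)
      (fun _ => secondEvent.indicator fun _ => 1))
  have hle (ω : RefineSpace) : decisionCost c x.1 x.2 (fun _ => firstEvent.indicator fun _ => 1)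
      (fun _ => secondEvent.indicator fun _ => 1) ω ≤ ENNReal.ofReal c * N + 1 := by
    unfold decisionCost
    have h1 (E : Set RefineSpace) :
        ENNReal.ofReal (1 - E.indicator (fun _ => (1 : ℝ)) ω) ≤ 1 := by
      rw [← ENNReal.ofReal_one]
      refine ENNReal.ofReal_le_ofReal (sub_le_self _ ?_)
      exact Set.indicator_nonneg (fun _ _ => zero_le_one) ω
    gcongr
    · rw [← ENat.toENNReal_coe]
      exact ENat.toENNReal_le.2 (hN ω)
    · split_ifs
      exacts [h1 _, h1 _]
  have hfin (h : Bool × Bool) : ∫⁻ ω, decisionCost c x.1 x.2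
      (fun _ => firstEvent.indicator fun _ => 1)
      (fun _ => secondEvent.indicator fun _ => 1) ω ∂typedLaw f₀ f₁ h ≠ ∞ := by
    refine ne_top_of_le_ne_top ?_ (lintegral_mono hle)
    rw [lintegral_const, measure_univ, mul_one]
    finiteness
  have hc (h : Bool × Bool) : Continuous fun p : ℝ × ℝ => ENNReal.ofReal (initialWeights p h) := by
    refine ENNReal.continuous_ofReal.comp ?_
    rcases h with ⟨_ | _, _ | _⟩ <;> simp only [initialWeights] <;> fun_prop
  have : ruleCost f₀ f₁ c ⟨x, hτ, ⟨N, hN⟩, hD⟩ = _ := funext e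
  rw [this]
  exact continuous_finsetSum _ fun h _ => (ENNReal.continuous_mul_const (hfin h)).comp (hc h)

/-- The family of rules is uncountable, so measurability comes from upper semicontinuity of an
infimum of continuous functions. -/
lemma measurable_iInf_ruleCost (hf₀ : IsPdf f₀) (hf₁ : IsPdf f₁) :
    Measurable fun p => ⨅ x, ruleCost f₀ f₁ c x p :=
  (upperSemicontinuous_iInf fun x =>
    (continuous_ruleCost hf₀ hf₁ x).upperSemicontinuous).measurable

lemma ae_q_bounds (hf₀ : IsPdf f₀) (hf₁ : IsPdf f₁) {p : ℝ × ℝ} (hp : p ∈ simplex) :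
    ∀ᵐ ω ∂refineLaw f₀ f₁ (initialWeights p), ∀ j,
      0 ≤ q₁ f₀ f₁ (initialWeights p) j ω := by
  have := isProbabilityMeasure_refineLaw hf₀ hf₁ hp
  exact ae_all_iff.2 fun j => (condExp_indicator_bounds (G.le j) measurableSet_firstEvent).mono
    fun ω h => h.1

lemma refineCost_le_ruleCost (hf₀ : IsPdf f₀) (hf₁ : IsPdf f₁) {p : ℝ × ℝ} (hp : p ∈ simplex)
    (x : DecisionRule) :
    refineCost f₀ f₁ c (initialWeights p) x.1.1 ≤ ruleCost f₀ f₁ c x p := by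
  obtain ⟨x, hτ, ⟨N, hN⟩, hD⟩ := x
  have htop (ω : RefineSpace) : x.1 ω ≠ ⊤ := ne_top_of_le_ne_top (ENat.natCast_ne_top N) (hN ω)
  refine le_of_le_of_eq ?_ (lintegral_decisionCost hf₀ hf₁ hp hτ htop hD).symm
  refine lintegral_mono fun ω => ?_
  have hn := ENat.natCast_toNat (htop ω)
  rw [decisionCost, stoppedValue_of_eq hn.symm, stoppedValue_of_eq hn.symm]
  gcongr
  split_ifs <;> refine ENNReal.ofReal_le_ofReal (sub_le_sub_left ?_ 1)
  exacts [le_max_left _ _, le_max_right _ _]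

/-- Choosing the candidate with the larger posterior realizes the maximum. This choice depends on
`p`, which is harmless because the infimum over rules is taken separately for each `p`. -/
lemma exists_ruleCost_eq (hf₀ : IsPdf f₀) (hf₁ : IsPdf f₁) {p : ℝ × ℝ} (hp : p ∈ simplex)
    {τ : RefineSpace → ℕ∞} (hτ : IsStoppingTime G τ) {N : ℕ} (hN : ∀ ω, τ ω ≤ N) :
    ∃ x : DecisionRule, ruleCost f₀ f₁ c x p = refineCost f₀ f₁ c (initialWeights p) τ := by
  have hD (j : ℕ) : MeasurableSet[G j]
      {ω | q₂ f₀ f₁ (initialWeights p) j ω ≤ q₁ f₀ f₁ (initialWeights p) j ω} :=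
    measurableSet_le stronglyMeasurable_condExp.measurable stronglyMeasurable_condExp.measurable
  have htop (ω : RefineSpace) : τ ω ≠ ⊤ := ne_top_of_le_ne_top (ENat.natCast_ne_top N) (hN ω)
  refine ⟨⟨(τ, _), hτ, ⟨N, hN⟩, hD⟩, ?_⟩
  refine (lintegral_decisionCost hf₀ hf₁ hp hτ htop hD).trans ?_
  refine lintegral_congr fun ω => ?_
  have hn := ENat.natCast_toNat (htop ω)
  rw [decisionCost, stoppedValue_of_eq hn.symm, stoppedValue_of_eq hn.symm]
  congr 1
  simp only [Set.mem_ofPred_eq]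
  split_ifs with h
  · rw [max_eq_left h]
  · rw [max_eq_right (not_le.1 h).le]

/-- Truncation lowers the observation cost and changes the loss only where `τ` exceeds `N`; there
the new loss is at most one. -/
lemma refineCost_min_le (hf₀ : IsPdf f₀) (hf₁ : IsPdf f₁) {p : ℝ × ℝ} (hp : p ∈ simplex)
    {τ σ : RefineSpace → ℕ∞} (hτ : IsStoppingTime G τ) {N : ℕ}
    (hσ : ∀ ω, σ ω = min (τ ω) (N : ℕ∞)) :
    refineCost f₀ f₁ c (initialWeights p) σ ≤ refineCost f₀ f₁ c (initialWeights p) τ +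
      refineLaw f₀ f₁ (initialWeights p) {ω | (N : ℕ∞) < τ ω} := by
  have hS : MeasurableSet {ω | (N : ℕ∞) < τ ω} :=
    measurable_of_isStoppingTime hτ (MeasurableSet.of_discrete (s := Set.Ioi (N : ℕ∞)))
  rw [← lintegral_indicator_one hS, refineCost, refineCost,
    ← lintegral_add_right _ (measurable_one.indicator hS)]
  refine lintegral_mono_ae ?_
  filter_upwards [ae_q_bounds hf₀ hf₁ hp] with ω hω
  by_cases h : (N : ℕ∞) < τ ω
  · have e : σ ω = N := (hσ ω).trans (min_eq_right h.le)
    rw [Set.indicator_of_mem (show ω ∈ {ω | (N : ℕ∞) < τ ω} from h), stoppedValue_of_eq e,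
      stoppedValue_of_eq e, e]
    refine add_le_add (le_trans ?_ le_self_add) ?_
    · gcongr
    · rw [Pi.one_apply, ← ENNReal.ofReal_one]
      exact ENNReal.ofReal_le_ofReal (sub_le_self _ ((hω N).trans (le_max_left _ _)))
  · have h' : τ ω ≤ N := not_lt.1 h
    have hn := ENat.natCast_toNat (ne_top_of_le_ne_top (ENat.natCast_ne_top N) h')
    have e : σ ω = τ ω := (hσ ω).trans (min_eq_left h')
    rw [stoppedValue_of_eq (e.trans hn.symm), stoppedValue_of_eq (e.trans hn.symm),
      stoppedValue_of_eq hn.symm, stoppedValue_of_eq hn.symm, e]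
    exact le_self_add

/-- A finite cost with `c > 0` forces `τ` to be almost surely finite, so the truncation error, the
probability that `τ` exceeds `N`, tends to zero. -/
lemma iInf_ruleCost_le (hf₀ : IsPdf f₀) (hf₁ : IsPdf f₁) (hc : 0 < c) {p : ℝ × ℝ}
    (hp : p ∈ simplex) {τ : RefineSpace → ℕ∞} (hτ : IsStoppingTime G τ) :
    ⨅ x, ruleCost f₀ f₁ c x p ≤ refineCost f₀ f₁ c (initialWeights p) τ := by
  have := isProbabilityMeasure_refineLaw hf₀ hf₁ hp
  by_cases hfin : refineCost f₀ f₁ c (initialWeights p) τ = ∞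
  · rw [hfin]
    exact le_top
  have hτm := measurable_of_isStoppingTime hτ
  have hS (N : ℕ) : MeasurableSet {ω | (N : ℕ∞) < τ ω} :=
    hτm (MeasurableSet.of_discrete (s := Set.Ioi (N : ℕ∞)))
  have htop : refineLaw f₀ f₁ (initialWeights p) (⋂ N : ℕ, {ω | (N : ℕ∞) < τ ω}) = 0 := by
    have hm : Measurable fun ω => ENNReal.ofReal c * (τ ω : ℝ≥0∞) :=
      ((measurable_of_countable _).comp hτm).const_mul _
    have hfin' : ∫⁻ ω, ENNReal.ofReal c * (τ ω : ℝ≥0∞) ∂refineLaw f₀ f₁ (initialWeights p) ≠ ∞ :=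
      ne_top_of_le_ne_top hfin (lintegral_mono fun ω => le_self_add)
    have hae := ae_lt_top hm hfin'
    refine measure_mono_null (fun ω hω => ?_) (ae_iff.1 hae)
    have : τ ω = ⊤ := by
      by_contra hne
      have := Set.mem_iInter.1 hω (τ ω).toNat
      rw [Set.mem_ofPred_eq, ENat.natCast_toNat hne] at this
      exact lt_irrefl _ this
    rw [Set.mem_ofPred_eq, this, ENat.toENNReal_top, ENNReal.mul_top (by simpa using hc)]
    exact lt_irrefl _
  have hanti : Antitone fun N : ℕ => {ω | (N : ℕ∞) < τ ω} := fun m n hmn ω hω =>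
    show (m : ℕ∞) < τ ω from lt_of_le_of_lt (Nat.cast_le.2 hmn) hω
  have hlim := tendsto_measure_iInter_atTop (μ := refineLaw f₀ f₁ (initialWeights p))
    (fun N => (hS N).nullMeasurableSet) hanti ⟨0, measure_ne_top _ _⟩
  rw [htop] at hlim
  have hlim' := hlim.const_add (refineCost f₀ f₁ c (initialWeights p) τ)
  rw [add_zero] at hlim'
  refine ge_of_tendsto' hlim' fun N => ?_
  obtain ⟨x, hx⟩ := exists_ruleCost_eq (c := c) hf₀ hf₁ hp (hτ.min_const N) (N := N)
    fun ω => min_le_right _ _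
  exact (iInf_le _ x).trans (hx.le.trans (refineCost_min_le hf₀ hf₁ hp hτ fun _ => rfl))

lemma iInf_refineCost_eq (hf₀ : IsPdf f₀) (hf₁ : IsPdf f₁) (hc : 0 < c) {p : ℝ × ℝ}
    (hp : p ∈ simplex) :
    (⨅ (τ : RefineSpace → ℕ∞) (_ : IsStoppingTime G τ),
      refineCost f₀ f₁ c (initialWeights p) τ) = ⨅ x, ruleCost f₀ f₁ c x p :=
  le_antisymm (le_iInf fun x => (iInf₂_le x.1.1 x.2.1).trans (refineCost_le_ruleCost hf₀ hf₁ hp x))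
    (le_iInf₂ fun _ hτ => iInf_ruleCost_le hf₀ hf₁ hc hp hτ)

lemma isUnitCost_v (hf₀ : IsPdf f₀) (hf₁ : IsPdf f₁) (hc : 0 < c) :
    IsUnitCost (v f₀ f₁ c) where
  measurable := by
    have : (fun p : simplex => v f₀ f₁ c p) =
        fun p : simplex => (⨅ x, ruleCost f₀ f₁ c x p).toReal := by
      ext p
      rw [v, refineValue, iInf_refineCost_eq hf₀ hf₁ hc p.2]
    rw [this]
    exact ((measurable_iInf_ruleCost hf₀ hf₁).comp measurable_subtype_coe).ennreal_toReal
  nonneg _ _ := ENNReal.toReal_nonneg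
  le_one p hp := by
    have := isProbabilityMeasure_refineLaw hf₀ hf₁ hp
    -- Choosing a candidate at time `0`, without any sample, already costs at most one.
    have h1 : refineCost f₀ f₁ c (initialWeights p) (fun _ => ((0 : ℕ) : ℕ∞)) ≤ 1 := by
      rw [refineCost]
      have h2 : ∫⁻ _, (1 : ℝ≥0∞) ∂refineLaw f₀ f₁ (initialWeights p) = 1 := by simp
      rw [← h2]
      refine lintegral_mono_ae ?_
      filter_upwards [ae_q_bounds hf₀ hf₁ hp] with ω hω
      have e (u : ℕ → RefineSpace → ℝ) : stoppedValue u (fun _ => ((0 : ℕ) : ℕ∞)) ω = u 0 ω :=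
        stoppedValue_of_eq (τ := fun _ => ((0 : ℕ) : ℕ∞)) rfl
      rw [e, e]
      simp only [Nat.cast_zero, ENat.toENNReal_zero, mul_zero, zero_add]
      rw [← ENNReal.ofReal_one]
      exact ENNReal.ofReal_le_ofReal (sub_le_self _ ((hω 0).trans (le_max_left _ _)))
    have h3 := (iInf₂_le (f := fun τ (_ : IsStoppingTime G τ) =>
      refineCost f₀ f₁ c (initialWeights p) τ) _ (isStoppingTime_const G 0)).trans h1
    exact (ENNReal.toReal_mono ENNReal.one_ne_top h3).trans_eq ENNReal.toReal_one

end Refine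

end MixedSearch

end

theorem mainTheorem5 (f₀ f₁ : ℝ → ℝ) (hf₀ : MixedSearch.IsPdf f₀) (hf₁ : MixedSearch.IsPdf f₁)
    (hne : MixedSearch.pdfMeasure f₀ ≠ MixedSearch.pdfMeasure f₁)
    (h₀₁ : MixedSearch.pdfMeasure f₀ ≪ MixedSearch.pdfMeasure f₁)
    (h₁₀ : MixedSearch.pdfMeasure f₁ ≪ MixedSearch.pdfMeasure f₀)
    (π₀ : ℝ) (hπ₀ : 0 ≤ π₀) (hπ₁ : π₀ ≤ 1) (c : ℝ) (hc : 0 < c) :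
    (∃ U : ℝ × ℝ → ℝ, MixedSearch.IsSolution f₀ f₁ π₀ c U) ∧
    ∀ U : ℝ × ℝ → ℝ, MixedSearch.IsSolution f₀ f₁ π₀ c U →
      MixedSearch.IsNextValue f₀ f₁ π₀ U ∧
      (∃ S : MixedSearch.ScanStrategy,
        MixedSearch.StopsByRule f₀ f₁ π₀ c U S ∧ MixedSearch.SwitchesByRule f₀ f₁ π₀ U S) ∧
      ∀ S : MixedSearch.ScanStrategy,
        MixedSearch.StopsByRule f₀ f₁ π₀ c U S → MixedSearch.SwitchesByRule f₀ f₁ π₀ U S →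
          MixedSearch.IsOptimal f₀ f₁ π₀ c S := by
  have hv := MixedSearch.isUnitCost_v hf₀ hf₁ hc
  refine ⟨?_, fun U hU => ⟨?_, ?_, ?_⟩⟩
  · obtain ⟨U, hUm, hUB, hU⟩ := MixedSearch.exists_solution hf₀ hf₁ hπ₀ hπ₁ hc hv
    exact ⟨U, hUm.comp measurable_subtype_coe, ⟨1, fun p _ => hUB p⟩, hU⟩
  · obtain ⟨B, hB⟩ := hU.bounded
    exact MixedSearch.isNextValue_of_measurable hf₀ hf₁ hπ₀ hπ₁ hU.measurable hB
  · exact MixedSearch.exists_optimal_rule hf₀ hf₁ hπ₀ hπ₁ hv hU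
  · intro S hS1 hS2 S'
    rw [MixedSearch.scanCost_eq_of_rule hf₀ hf₁ hπ₀ hπ₁ hc hv hU hS1 hS2]
    exact MixedSearch.ofReal_le_scanCost hf₀ hf₁ hπ₀ hπ₁ hc hv hU S'
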